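/- **Setting.** There are $l$ primaries (sellers), each owning one channel, and a finite non-empty conflict graph $G=(V,E)$ whose nodes are locations; at every node there are $m$ secondaries (buyers), $1\le m<l$. Independently across primaries, a primary's channel is in state $j\in\{1,\dots,n\}$ (the same at all nodes) with probability $q_j>0$ and in state $0$ (unavailable) with the remaining probability, where $\sum_{j=1}^n q_j<1$. A channel in state $j$ offered at price $p\ge 0$ incurs the penalty $g_j(p)$, where $g_j$ is continuous and strictly increasing on $[0,\infty)$ with inverse $f_j$, and $g_i(p)<g_j(p)$ if $i>j$. A sale costs $c\ge 0$; secondaries accept only penalties at most $v$, where for every $j\in\{1,\dots,n\}$ $v$ lies in the range of $g_j$ and $g_j(c)<v$ (i.e. $f_j(v)>c$). For $i<j$, $$\frac{f_i(y)-c}{f_j(y)-c}<\frac{f_i(x)-c}{f_j(x)-c}\quad\text{whenever } x>y>g_i(c)\text{ and } f_i(x),f_j(x)\text{ are defined.}$$ **Game.** Knowing only the state $j\ge1$ of its own channel, a primary chooses an independent set of $G$ at random, and a random penalty (in the range of $g_j$) at each node of that set. At each node the (at most) $m$ offered channels with the lowest penalties among those with penalty $\le v$ are sold, ties being broken uniformly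 at random. A sale at penalty $x$ of a channel in state $j$ yields $f_j(x)-c$, no sale yields $0$, and payoffs add up over the nodes of the chosen set. A strategy profile is a Nash equilibrium (NE) if for every primary and every state $j\in\{1,\dots,n\}$ no change of that primary's behaviour in state $j$ increases its expected payoff in state $j$. **Partitions.** Disjoint maximal independent sets $I_1,\dots,I_d$ ($d\ge 2$) with union $V$ and $M_s=|I_s|$, $M_1\ge\dots\ge M_d$, *characterize $G$ as a mean valid graph* if $\sum_{s=1}^d |A\cap I_s|/M_s\le 1$ for every independent set $A$. **Selection according to a partition.** Let $w(x)=\sum_{i=m}^{l-1}\binom{l-1}{i}x^i(1-x)^{l-1-i}$ and $W=1-w$ on $[0,1]$. A primary *selects among $I_1,\dots,I_d$ in state $j$ according to (dist) and (ne2)* if it chooses $I_s$ with probability $t_{s,j}$, where the numbers $t_{s,k}$, with $\gamma_{s,k}=\sum_{i=k}^n q_it_{s,i}$, satisfy for every $k\in\{1,\dots,n\}$: $\sum_s t_{s,k}=1$, and there is $d_k\in\{1,\dots,d\}$ with $t_{s,k}>0$ for $s\le d_k$, $t_{s,k}=0$ for $s>d_k$, and $$M_1W(\gamma_{1,k})=\dots=M_{d_k}W(\gamma_{d_k,k})\ge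 M_{d_k+1}W(\gamma_{d_k+1,k})\ge\dots\ge M_dW(\gamma_{d,k});$$ and if at each node of each $I_s$ with $t_{s,j}>0$ its penalty has the distribution function $$\phi_{s,j}(x)=\begin{cases}0,&x<L_{s,j},\\ \frac{1}{q_jt_{s,j}}\Big(w^{-1}\Big(\frac{f_j(x)-p_{s,j}}{f_j(x)-c}\Big)-\gamma_{s,j+1}\Big),&L_{s,j}\le x\le L_{s,j-1},\\ 1,&x>L_{s,j-1},\end{cases}$$ where $\gamma_{s,n+1}=0$, $L_{s,0}=v$, $p_{s,k}-c=(f_k(L_{s,k-1})-c)W(\gamma_{s,k})$ and $L_{s,k}=g_k\big(\tfrac{p_{s,k}-c}{W(\gamma_{s,k+1})}+c\big)$. **Theorem.** Suppose that $I_1,\dots,I_d$ and $\bar I_1,\dots,\bar I_{\bar d}$ both characterize $G$ as a mean valid graph. 1. Every strategy profile in which, in each state $j\in\{1,\dots,n\}$, some of the primaries (any number $n_j$ with $0\le n_j\le l$) select among $I_1,\dots,I_d$ and all others select among $\bar I_1,\dots,\bar I_{\bar d}$, each according to (dist) and (ne2), is an NE. 2. For every node $a$ and state $j\in\{1,\dots,n\}$,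 the probability $\alpha_{a,j}$ that a primary's channel is in state $j$ and is offered at $a$ is the same whether the primary selects among $I_1,\dots,I_d$ or among $\bar I_1,\dots,\bar I_{\bar d}$ in state $j$ according to (dist) and (ne2). 3. The multisets of cardinalities $\{|I_1|,\dots,|I_d|\}$ and $\{|\bar I_1|,\dots,|\bar I_{\bar d}|\}$ are equal, and $I_s\cap\bar I_k=\emptyset$ whenever $|I_s|\ne|\bar I_k|$. -/

import Mathlib

open MeasureTheory

noncomputable section

namespace SpectrumMarket

/-- The parameters of the market: `l` primaries, `m` secondaries at every location, channel states
`0, 1, …, n` (state `0` means that the channel is unavailable), cost `c` of a sale, largest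
acceptable penalty `v`, probability `q j` that a channel is in state `j` for `1 ≤ j ≤ n` (state `0`
has the remaining probability), and penalty `g j p` of a channel in state `j` offered at the price
`p ≥ 0`. The values of `q` and `g` at indices outside `1, …, n` play no role. -/
structure Market where
  l : ℕ
  m : ℕ
  n : ℕ
  c : ℝ
  v : ℝ
  q : ℕ → ℝ
  g : ℕ → ℝ → ℝ

namespace Market

variable (mkt : Market)

/-- The channel states in which the channel can be sold. -/
def states : Finset ℕ := Finset.Icc 1 mkt.n

/-- The penalties that a channel in state `j` can incur at some price `p ≥ 0`. -/
def penalties (j : ℕ) : Set ℝ := mkt.g j '' Set.Ici 0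

/-- The inverse `f j` of the penalty function `g j` on prices `p ≥ 0`: for `x ∈ penalties j`,
`f j x` is the price at which a channel in state `j` incurs the penalty `x`. -/
def f (j : ℕ) (x : ℝ) : ℝ := Function.invFunOn (mkt.g j) (Set.Ici 0) x

/-- The standing assumptions on the market. -/
structure IsStandard : Prop where
  one_le_m : 1 ≤ mkt.m
  m_lt_l : mkt.m < mkt.l
  c_nonneg : 0 ≤ mkt.c
  q_pos : ∀ j ∈ mkt.states, 0 < mkt.q j
  sum_q_lt_one : ∑ j ∈ mkt.states, mkt.q j < 1
  g_strictMono : ∀ j ∈ mkt.states, StrictMonoOn (mkt.g j) (Set.Ici 0)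
  g_continuous : ∀ j ∈ mkt.states, ContinuousOn (mkt.g j) (Set.Ici 0)
  /-- A channel of higher transmission rate incurs a lower penalty at the same price. -/
  g_lt : ∀ i ∈ mkt.states, ∀ j ∈ mkt.states, i < j → ∀ p, 0 ≤ p → mkt.g j p < mkt.g i p
  /-- The price `f j v` of the largest acceptable penalty exists, ... -/
  v_mem : ∀ j ∈ mkt.states, mkt.v ∈ mkt.penalties j
  /-- ... and it exceeds the cost of a sale. -/
  g_c_lt_v : ∀ j ∈ mkt.states, mkt.g j mkt.c < mkt.v
  /-- The ratio assumption on the inverse penalty functions. -/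
  ratio_lt : ∀ i ∈ mkt.states, ∀ j ∈ mkt.states, i < j → ∀ x y,
    x ∈ mkt.penalties i → x ∈ mkt.penalties j → y < x → mkt.g i mkt.c < y →
      (mkt.f i y - mkt.c) / (mkt.f j y - mkt.c) < (mkt.f i x - mkt.c) / (mkt.f j x - mkt.c)

/-- The probability of at least `m` successes in `l - 1` independent trials, each of success
probability `x`. -/
def w (x : ℝ) : ℝ :=
  ∑ i ∈ Finset.Icc mkt.m (mkt.l - 1),
    ((mkt.l - 1).choose i : ℝ) * x ^ i * (1 - x) ^ (mkt.l - 1 - i)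

/-- `W = 1 - w`. -/
def W (x : ℝ) : ℝ := 1 - mkt.w x

/-- The inverse of `w : [0, 1] → [0, 1]`. -/
def wInv (y : ℝ) : ℝ := Function.invFunOn mkt.w (Set.Icc 0 1) y

/-- `α j + α (j + 1) + ⋯ + α n`: the probability that a channel of state `j` or higher is offered
at a node, if a channel of state `k` is offered there with probability `α k`. -/
def tail (α : ℕ → ℝ) (j : ℕ) : ℝ := ∑ k ∈ Finset.Icc j mkt.n, α k

/-- The end-points `L 0 = v, L 1, …, L n` of the penalty intervals at a node where a channel of
state `k` is offered with probability `α k`: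
`L j = g j ((p j - c) / W (α (j+1) + ⋯ + α n) + c)`,
where `p j - c = (f j (L (j-1)) - c) * W (α j + ⋯ + α n)`. -/
def L (α : ℕ → ℝ) : ℕ → ℝ
  | 0 => mkt.v
  | j + 1 =>
    mkt.g (j + 1)
      ((mkt.f (j + 1) (L α j) - mkt.c) * mkt.W (mkt.tail α (j + 1)) / mkt.W (mkt.tail α (j + 2))
        + mkt.c)

/-- `p j = c + (f j (L (j-1)) - c) * W (α j + ⋯ + α n)`. -/
def p (α : ℕ → ℝ) (j : ℕ) : ℝ :=
  mkt.c + (mkt.f j (mkt.L α (j - 1)) - mkt.c) * mkt.W (mkt.tail α j)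

/-- The distribution function of the penalty in state `j` at a node where a channel of state `k`
is offered with probability `α k`, `k = 1, …, n` (the single-location equilibrium distribution
with `α k` in place of `q k`). -/
def phi (α : ℕ → ℝ) (j : ℕ) (x : ℝ) : ℝ :=
  if x < mkt.L α j then 0
  else if x ≤ mkt.L α (j - 1) then
    1 / α j *
      (mkt.wInv ((mkt.f j x - mkt.p α j) / (mkt.f j x - mkt.c)) - mkt.tail α (j + 1))
  else 1

end Market

/-- The disjoint maximal independent sets `I 0, …, I (d-1)`, ordered by decreasing cardinality,
partition the nodes of `G` and characterize `G` as a mean valid graph. -/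
structure IsMeanValidPartition {V : Type*} [Fintype V] [DecidableEq V] (G : SimpleGraph V)
    {d : ℕ} (I : Fin d → Finset V) : Prop where
  two_le : 2 ≤ d
  maximal : ∀ s, Maximal (fun A : Finset V => G.IsIndepSet (A : Set V)) (I s)
  disjoint : ∀ s r, s ≠ r → Disjoint (I s) (I r)
  cover : ∀ a, ∃ s, a ∈ I s
  card_antitone : ∀ s r, s ≤ r → (I r).card ≤ (I s).card
  sum_le_one : ∀ A : Finset V, G.IsIndepSet (A : Set V) →
    ∑ s, ((A ∩ I s).card : ℝ) / ((I s).card : ℝ) ≤ 1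

section Game

variable {V : Type*} [Fintype V] [DecidableEq V]

/-- What a primary does when its channel is in state `j`: it picks the independent set `A` with
probability `β A`, and then, at every node `a` of `A`, a penalty with law `pen A a`. -/
structure StateStrategy (mkt : Market) (G : SimpleGraph V) (j : ℕ) where
  β : Finset V → ℝ
  pen : Finset V → V → Measure ℝ
  β_nonneg : ∀ A, 0 ≤ β A
  β_sum : ∑ A, β A = 1
  β_indep : ∀ A, β A ≠ 0 → G.IsIndepSet (A : Set V)
  pen_prob : ∀ A a, IsProbabilityMeasure (pen A a)
  pen_mem : ∀ A a, ∀ᵐ x ∂(pen A a), x ∈ mkt.penalties j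

/-- A strategy of a primary: what it does in every channel state (only the states `1, …, n`
play a role). -/
abbrev Strategy (mkt : Market) (G : SimpleGraph V) : Type _ := (j : ℕ) → StateStrategy mkt G j

variable {mkt : Market} {G : SimpleGraph V}

/-- The node-selection probability `α_{a,j}`: the probability that the channel is in state `j` and
is offered at the node `a`. -/
def nodeProb (σ : Strategy mkt G) (a : V) (j : ℕ) : ℝ :=
  ∑ A : Finset V with a ∈ A, mkt.q j * (σ j).β A

/-- The law of the penalty at which a primary that uses `σ` offers its channel at the node `a`,
with the value `⊤` if the channel is not offered there. -/
def offerLaw (σ : Strategy mkt G) (a : V) : Measure EReal :=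
  ENNReal.ofReal (1 - ∑ j ∈ mkt.states, nodeProb σ a j) • Measure.dirac ⊤ +
    ∑ j ∈ mkt.states, ∑ A : Finset V with a ∈ A,
      ENNReal.ofReal (mkt.q j * (σ j).β A) •
        ((σ j).pen A a).map (fun x : ℝ => (x : EReal))

open Classical in
/-- The probability that a channel with penalty `x` is sold at a node where the channels of the
competitors have penalties `y k` (`⊤` if not offered). Penalties above `v` are not accepted, the
at most `m` channels with the lowest penalties are sold, and ties are broken uniformly. -/
def saleProb (mkt : Market) {ι : Type*} [Fintype ι] (x : ℝ) (y : ι → EReal) : ℝ :=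
  let below : ℕ := (Finset.univ.filter fun k => y k < (x : EReal)).card
  let ties : ℕ := (Finset.univ.filter fun k => y k = (x : EReal)).card
  if mkt.v < x ∨ mkt.m ≤ below then 0
  else min 1 (((mkt.m : ℝ) - (below : ℝ)) / ((ties : ℝ) + 1))

/-- The probability that primary `i` sells its channel at the node `a` if it offers it there with
penalty `x`; the competitors act independently of each other. -/
def winProb (S : Fin mkt.l → Strategy mkt G) (i : Fin mkt.l) (a : V) (x : ℝ) : ℝ :=
  ∫ y, saleProb mkt x y ∂(Measure.pi fun k : {k : Fin mkt.l // k ≠ i} => offerLaw (S k) a)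

/-- The expected payoff of primary `i` when its channel is in state `j`, it acts according to `ψ`,
and the others use their strategies in the profile `S`. -/
def expectedPayoff (S : Fin mkt.l → Strategy mkt G) (i : Fin mkt.l) (j : ℕ)
    (ψ : StateStrategy mkt G j) : ℝ :=
  ∑ A : Finset V, ψ.β A *
    ∑ a ∈ A, ∫ x, (mkt.f j x - mkt.c) * winProb S i a x ∂(ψ.pen A a)

/-- Nash equilibrium: in no channel state can a primary gain by a unilateral deviation. -/
def IsNash (S : Fin mkt.l → Strategy mkt G) : Prop :=
  ∀ i, ∀ j ∈ mkt.states, ∀ ψ : StateStrategy mkt G j,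
    expectedPayoff S i j ψ ≤ expectedPayoff S i j (S i j)

/-- `t s j` is the probability of the `s`-th part of the partition `I` in state `j`. In every state
`j = 1, …, n` exactly the first `dj` parts (for some `dj`) have positive probability, and with
`γ s j = ∑_{k = j}^n q k * t s k` the numbers `|I s| * W (γ s j)` are equal for the first `dj` parts
and decrease weakly along all parts. -/
def IsSelection (mkt : Market) {d : ℕ} (I : Fin d → Finset V) (t : Fin d → ℕ → ℝ) : Prop :=
  ∀ j ∈ mkt.states,
    ∑ s, t s j = 1 ∧
    ∃ dj : ℕ, 1 ≤ dj ∧ dj ≤ d ∧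
      (∀ s : Fin d, (s : ℕ) < dj → 0 < t s j) ∧
      (∀ s : Fin d, dj ≤ (s : ℕ) → t s j = 0) ∧
      (∀ s r : Fin d, (s : ℕ) < dj → (r : ℕ) < dj →
        ((I s).card : ℝ) * mkt.W (mkt.tail (fun k => mkt.q k * t s k) j) =
          ((I r).card : ℝ) * mkt.W (mkt.tail (fun k => mkt.q k * t r k) j)) ∧
      (∀ s r : Fin d, s ≤ r →
        ((I r).card : ℝ) * mkt.W (mkt.tail (fun k => mkt.q k * t r k) j) ≤
          ((I s).card : ℝ) * mkt.W (mkt.tail (fun k => mkt.q k * t s k) j))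

/-- In state `j` the primary selects among the parts of the partition `I` with the probabilities
`t s j` of a family `t` as above, and at every node of a part `I s` that it selects with positive
probability it uses the penalty distribution `phi` for the node-selection probabilities
`q k * t s k`, `k = 1, …, n`. -/
def FollowsPartition {j : ℕ} (ψ : StateStrategy mkt G j) {d : ℕ} (I : Fin d → Finset V) : Prop :=
  ∃ t : Fin d → ℕ → ℝ, IsSelection mkt I t ∧
    (∀ s, ψ.β (I s) = t s j) ∧
    (∀ s, 0 < t s j → ∀ a ∈ I s, ∀ x : ℝ,
      (ψ.pen (I s) a).real (Set.Iic x) = mkt.phi (fun k => mkt.q k * t s k) j x)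

end Game

end SpectrumMarket

end

/-! ### The functions `w` and `W`, and the inverse penalty functions. -/

namespace SpectrumMarket

namespace Market

variable {mkt : Market}

/-! Everything rests on one combinatorial fact: two mean valid partitions give every node a part of
the same size. Put x_a = 1/|part of a in I| and y_a = 1/|part of a in I'|. Each part of I has x-sum
1, and every independent set has x-sum at most 1. Summing x over all nodes, by I and then by I',
gives d ≤ d'; by symmetry d = d', so every part of I' also has x-sum exactly 1. As y is constant on
the parts of I', this yields ∑ x_a y_a = ∑ y_a², and symmetrically ∑ x_a y_a = ∑ x_a². Hence ∑ (x_a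
- y_a)² = 0 and x = y (`card_part_eq`). The statements on cardinalities follow at once.

The selection probabilities depend only on the part sizes: going down from the highest state, each
state solves a water-filling problem for the strictly decreasing `W`, whose solution is unique
(`IsSelection.eq_of_card_eq`). So whichever partition a primary uses, every node sees the same load
and the same penalty distribution (`FollowsPartition.offers`); this gives the equality of node
probabilities.

For the equilibrium, fix a node. All competitors offer there with the same atomless law, so a
penalty x ≤ v wins with probability W(F(x)), where F is `offerCdf`. On the interval [L j, L (j-1)]
the profit (f_j(x) - c) W(F(x)) is constantly p_j - c, and the ratio assumption shows that no
penalty earns more in state j (`profit_mul_W_offerCdf_le`). Across nodes, M_s (p_{s,j} - c) equals a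
common U for the parts in use and is at most U for the others (`IsSelection.exists_profit`). A
deviation to an independent set A then earns at most U ∑_{a ∈ A} x_a ≤ U by mean validity, while a
part in use earns exactly U. -/

theorem mem_states {j : ℕ} : j ∈ mkt.states ↔ 1 ≤ j ∧ j ≤ mkt.n := Finset.mem_Icc

theorem w_eq_eval (x : ℝ) :
    mkt.w x = (∑ i ∈ Finset.Icc mkt.m (mkt.l - 1), bernsteinPolynomial ℝ (mkt.l - 1) i).eval x := by
  simp [w, Polynomial.eval_finsetSum, bernsteinPolynomial]

theorem continuous_w : Continuous mkt.w := by
  unfold w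
  fun_prop

/-- Differentiating a Bernstein polynomial gives a difference of two consecutive ones of degree one
less, so the sum telescopes; the upper end term vanishes because its index exceeds the degree. The
positivity of the remaining term on (0, 1) makes `w` strictly increasing. -/
theorem derivative_sum_bernsteinPolynomial (N m : ℕ) (hm : m + 1 ≤ N) :
    Polynomial.derivative (∑ i ∈ Finset.Icc (m + 1) N, bernsteinPolynomial ℝ N i) =
      N * bernsteinPolynomial ℝ (N - 1) m := by
  obtain ⟨k, rfl⟩ := Nat.exists_eq_add_of_le hm
  -- The degree is decoupled from the upper limit of the sum, so that the induction moves only the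
  -- limit.
  have h : ∀ k N : ℕ, Polynomial.derivative
      (∑ i ∈ Finset.Icc (m + 1) (m + 1 + k), bernsteinPolynomial ℝ N i) =
      N * (bernsteinPolynomial ℝ (N - 1) m - bernsteinPolynomial ℝ (N - 1) (m + 1 + k)) := by
    intro k N
    induction k with
    | zero => simp [bernsteinPolynomial.derivative_succ]
    | succ k ih =>
      rw [← add_assoc, Finset.sum_Icc_succ_top (by omega), Polynomial.derivative_add, ih,
        bernsteinPolynomial.derivative_succ]
      ring
  rw [h, bernsteinPolynomial.eq_zero_of_lt (n := m + 1 + k - 1) (ν := m + 1 + k) ℝ (by omega),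
    sub_zero]

theorem w_zero (h : mkt.IsStandard) : mkt.w 0 = 0 := by
  unfold w
  refine Finset.sum_eq_zero fun i hi => ?_
  have := h.one_le_m
  have hi' := (Finset.mem_Icc.1 hi).1
  rw [zero_pow (by omega)]
  simp

theorem w_one (h : mkt.IsStandard) : mkt.w 1 = 1 := by
  unfold w
  have := h.m_lt_l
  rw [Finset.sum_eq_single (mkt.l - 1)]
  · simp
  · intro i hi hne
    have := (Finset.mem_Icc.1 hi).2
    rw [sub_self, zero_pow (by omega), mul_zero]
  · intro hn
    exact absurd (Finset.mem_Icc.2 ⟨by omega, le_rfl⟩) hn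

theorem strictMonoOn_w (h : mkt.IsStandard) : StrictMonoOn mkt.w (Set.Icc 0 1) := by
  refine strictMonoOn_of_deriv_pos (convex_Icc 0 1) continuous_w.continuousOn fun x hx => ?_
  rw [interior_Icc] at hx
  have h1 := h.one_le_m
  have h2 := h.m_lt_l
  obtain ⟨m, hm⟩ := Nat.exists_eq_add_of_le' h1
  have hw : mkt.w = fun x =>
      (∑ i ∈ Finset.Icc (m + 1) (mkt.l - 1), bernsteinPolynomial ℝ (mkt.l - 1) i).eval x := by
    funext x
    rw [w_eq_eval, hm]
  rw [hw, Polynomial.deriv, derivative_sum_bernsteinPolynomial _ _ (by omega)]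
  have hx0 : 0 < x := hx.1
  have hx1 : 0 < 1 - x := sub_pos.2 hx.2
  have hc : 0 < (mkt.l - 1 - 1).choose m := Nat.choose_pos (by omega)
  have hl : 0 < mkt.l - 1 := by omega
  simp only [bernsteinPolynomial, Polynomial.eval_mul, Polynomial.eval_natCast,
    Polynomial.eval_pow, Polynomial.eval_sub, Polynomial.eval_one, Polynomial.eval_X]
  positivity

theorem W_zero (h : mkt.IsStandard) : mkt.W 0 = 1 := by simp [W, w_zero h]

theorem strictAntiOn_W (h : mkt.IsStandard) : StrictAntiOn mkt.W (Set.Icc 0 1) := by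
  intro x hx y hy hxy
  have := strictMonoOn_w h hx hy hxy
  unfold W
  linarith

theorem W_nonneg (h : mkt.IsStandard) {x : ℝ} (hx : x ∈ Set.Icc (0 : ℝ) 1) : 0 ≤ mkt.W x := by
  have := (strictMonoOn_w h).monotoneOn hx (Set.right_mem_Icc.2 zero_le_one) hx.2
  rw [w_one h] at this
  unfold W
  linarith

theorem W_le_one (h : mkt.IsStandard) {x : ℝ} (hx : x ∈ Set.Icc (0 : ℝ) 1) : mkt.W x ≤ 1 := by
  have := (strictMonoOn_w h).monotoneOn (Set.left_mem_Icc.2 zero_le_one) hx hx.1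
  rw [w_zero h] at this
  unfold W
  linarith

theorem W_pos (h : mkt.IsStandard) {x : ℝ} (hx : 0 ≤ x) (hx1 : x < 1) : 0 < mkt.W x := by
  have := strictMonoOn_w h ⟨hx, hx1.le⟩ (Set.right_mem_Icc.2 zero_le_one) hx1
  rw [w_one h] at this
  unfold W
  linarith

theorem surjOn_w (h : mkt.IsStandard) : Set.SurjOn mkt.w (Set.Icc 0 1) (Set.Icc 0 1) := by
  have := intermediate_value_Icc zero_le_one (continuous_w (mkt := mkt)).continuousOn
  rwa [w_zero h, w_one h] at this

theorem wInv_mem (h : mkt.IsStandard) {y : ℝ} (hy : y ∈ Set.Icc (0 : ℝ) 1) :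
    mkt.wInv y ∈ Set.Icc (0 : ℝ) 1 :=
  Function.invFunOn_mem (surjOn_w h hy)

theorem w_wInv (h : mkt.IsStandard) {y : ℝ} (hy : y ∈ Set.Icc (0 : ℝ) 1) :
    mkt.w (mkt.wInv y) = y :=
  Function.invFunOn_eq (surjOn_w h hy)

theorem wInv_w (h : mkt.IsStandard) {x : ℝ} (hx : x ∈ Set.Icc (0 : ℝ) 1) :
    mkt.wInv (mkt.w x) = x :=
  (strictMonoOn_w h).injOn.leftInvOn_invFunOn hx

theorem f_nonneg {j : ℕ} {x : ℝ} (hx : x ∈ mkt.penalties j) : 0 ≤ mkt.f j x :=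
  Function.invFunOn_mem hx

theorem g_f {j : ℕ} {x : ℝ} (hx : x ∈ mkt.penalties j) : mkt.g j (mkt.f j x) = x :=
  Function.invFunOn_eq hx

theorem f_g (h : mkt.IsStandard) {j : ℕ} (hj : j ∈ mkt.states) {p : ℝ} (hp : 0 ≤ p) :
    mkt.f j (mkt.g j p) = p :=
  (h.g_strictMono j hj).injOn.leftInvOn_invFunOn hp

theorem strictMonoOn_f (h : mkt.IsStandard) {j : ℕ} (hj : j ∈ mkt.states) :
    StrictMonoOn (mkt.f j) (mkt.penalties j) := by
  rintro _ ⟨p, hp, rfl⟩ _ ⟨r, hr, rfl⟩ hlt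
  rw [f_g h hj hp, f_g h hj hr]
  exact ((h.g_strictMono j hj).lt_iff_lt hp hr).1 hlt

theorem mem_penalties (h : mkt.IsStandard) {j : ℕ} (hj : j ∈ mkt.states) {x : ℝ}
    (hx : mkt.g j mkt.c ≤ x) (hxv : x ≤ mkt.v) : x ∈ mkt.penalties j := by
  obtain ⟨r, hr, hrv⟩ := h.v_mem j hj
  have hcr : mkt.c ≤ r := by
    by_contra! hlt
    have := h.g_strictMono j hj hr h.c_nonneg hlt
    have := h.g_c_lt_v j hj
    linarith
  obtain ⟨y, hy, rfl⟩ := intermediate_value_Icc hcr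
    ((h.g_continuous j hj).mono fun y hy => h.c_nonneg.trans hy.1) ⟨hx, hxv.trans_eq hrv.symm⟩
  exact ⟨y, h.c_nonneg.trans hy.1, rfl⟩

theorem c_lt_f (h : mkt.IsStandard) {j : ℕ} (hj : j ∈ mkt.states) {x : ℝ}
    (hx : mkt.g j mkt.c < x) (hxv : x ≤ mkt.v) : mkt.c < mkt.f j x := by
  have := strictMonoOn_f h hj ⟨mkt.c, h.c_nonneg, rfl⟩ (mem_penalties h hj hx.le hxv) hx
  rwa [f_g h hj h.c_nonneg] at this

theorem g_c_antitone (h : mkt.IsStandard) {i j : ℕ} (hi : i ∈ mkt.states) (hj : j ∈ mkt.states)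
    (hij : i ≤ j) : mkt.g j mkt.c ≤ mkt.g i mkt.c := by
  rcases hij.eq_or_lt with rfl | hlt
  · exact le_rfl
  · exact (h.g_lt i hi j hj hlt _ h.c_nonneg).le

theorem profit_mul_le (h : mkt.IsStandard) {i j : ℕ} (hi : i ∈ mkt.states) (hj : j ∈ mkt.states)
    (hij : i ≤ j) {x y : ℝ} (hy : mkt.g i mkt.c < y) (hyx : y ≤ x) (hx : x ≤ mkt.v) :
    (mkt.f i y - mkt.c) * (mkt.f j x - mkt.c) ≤ (mkt.f i x - mkt.c) * (mkt.f j y - mkt.c) := by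
  rcases hij.eq_or_lt with rfl | hij
  · rw [mul_comm]
  rcases hyx.eq_or_lt with rfl | hyx
  · rfl
  have hyj := (g_c_antitone h hi hj hij.le).trans_lt hy
  have := h.ratio_lt i hi j hj hij x y (mem_penalties h hi (hy.trans hyx).le hx)
    (mem_penalties h hj (hyj.trans hyx).le hx) hyx hy
  rw [div_lt_div_iff₀ (sub_pos.2 (c_lt_f h hj hyj (hyx.le.trans hx)))
    (sub_pos.2 (c_lt_f h hj (hyj.trans hyx) hx))] at this
  exact this.le

end Market

end SpectrumMarket

/-! ### Penalty intervals, the offered penalties at one node, and best responses there. -/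

namespace SpectrumMarket

namespace Market

variable {mkt : Market}

/-- `α k` is a possible probability that a channel of state `k` is offered at a node. -/
def IsLoad (mkt : Market) (α : ℕ → ℝ) : Prop :=
  ∀ k ∈ mkt.states, 0 ≤ α k ∧ α k ≤ mkt.q k

variable {α : ℕ → ℝ}

theorem mem_states_of_mem_Icc {j k : ℕ} (hj : 1 ≤ j) (hk : k ∈ Finset.Icc j mkt.n) :
    k ∈ mkt.states :=
  mem_states.2 ⟨hj.trans (Finset.mem_Icc.1 hk).1, (Finset.mem_Icc.1 hk).2⟩

theorem tail_nonneg (hα : mkt.IsLoad α) {j : ℕ} (hj : 1 ≤ j) : 0 ≤ mkt.tail α j :=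
  Finset.sum_nonneg fun k hk => (hα k (mem_states_of_mem_Icc hj hk)).1

theorem tail_lt_one (h : mkt.IsStandard) (hα : mkt.IsLoad α) {j : ℕ} (hj : 1 ≤ j) :
    mkt.tail α j < 1 := by
  refine lt_of_le_of_lt ?_ h.sum_q_lt_one
  refine (Finset.sum_le_sum fun k hk => (hα k (mem_states_of_mem_Icc hj hk)).2).trans ?_
  exact Finset.sum_le_sum_of_subset_of_nonneg (fun k hk => mem_states_of_mem_Icc hj hk)
    fun k hk _ => (h.q_pos k hk).le

theorem tail_mem (h : mkt.IsStandard) (hα : mkt.IsLoad α) {j : ℕ} (hj : 1 ≤ j) :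
    mkt.tail α j ∈ Set.Icc (0 : ℝ) 1 :=
  ⟨tail_nonneg hα hj, (tail_lt_one h hα hj).le⟩

theorem tail_eq_add {j : ℕ} (hj : j ≤ mkt.n) (α : ℕ → ℝ) :
    mkt.tail α j = α j + mkt.tail α (j + 1) := by
  unfold tail
  rw [← Finset.insert_Icc_add_one_left_eq_Icc hj, Finset.sum_insert (by simp)]

theorem tail_of_lt {j : ℕ} (hj : mkt.n < j) (α : ℕ → ℝ) : mkt.tail α j = 0 := by
  simp [tail, hj]

theorem tail_congr {β : ℕ → ℝ} (hβ : ∀ k ∈ mkt.states, α k = β k) {j : ℕ} (hj : 1 ≤ j) :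
    mkt.tail α j = mkt.tail β j :=
  Finset.sum_congr rfl fun k hk => hβ k (mem_states_of_mem_Icc hj hk)

theorem W_tail_pos (h : mkt.IsStandard) (hα : mkt.IsLoad α) {j : ℕ} (hj : 1 ≤ j) :
    0 < mkt.W (mkt.tail α j) :=
  W_pos h (tail_nonneg hα hj) (tail_lt_one h hα hj)

theorem tail_succ_le (hα : mkt.IsLoad α) {j : ℕ} (hj : j ∈ mkt.states) :
    mkt.tail α (j + 1) ≤ mkt.tail α j := by
  have := (hα j hj).1
  rw [tail_eq_add (mem_states.1 hj).2]
  linarith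

theorem W_tail_le (h : mkt.IsStandard) (hα : mkt.IsLoad α) {j : ℕ} (hj : j ∈ mkt.states) :
    mkt.W (mkt.tail α j) ≤ mkt.W (mkt.tail α (j + 1)) :=
  (strictAntiOn_W h).antitoneOn (tail_mem h hα (by omega)) (tail_mem h hα (mem_states.1 hj).1)
    (tail_succ_le hα hj)

theorem L_congr {β : ℕ → ℝ} (hβ : ∀ k ∈ mkt.states, α k = β k) (j : ℕ) :
    mkt.L α j = mkt.L β j := by
  induction j with
  | zero => rfl
  | succ j ih =>
    simp only [L]
    rw [ih, tail_congr hβ (by omega : 1 ≤ j + 1), tail_congr hβ (by omega : 1 ≤ j + 2)]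

theorem L_eq {j : ℕ} (hj : 1 ≤ j) (α : ℕ → ℝ) :
    mkt.L α j = mkt.g j ((mkt.f j (mkt.L α (j - 1)) - mkt.c) * mkt.W (mkt.tail α j) /
      mkt.W (mkt.tail α (j + 1)) + mkt.c) := by
  obtain ⟨i, rfl⟩ := Nat.exists_eq_add_of_le' hj
  rfl

/-- The three claims need a joint induction: evaluating `f` at the previous end-point makes sense
only once that point is known to lie between `g k c` and `v`. -/
theorem L_bounds (h : mkt.IsStandard) (hα : mkt.IsLoad α) {j : ℕ} (hj : j ≤ mkt.n) :
    mkt.L α j ≤ mkt.v ∧ (∀ k ∈ mkt.states, j ≤ k → mkt.g k mkt.c < mkt.L α j) ∧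
      (1 ≤ j → mkt.L α j ≤ mkt.L α (j - 1)) := by
  induction j with
  | zero => exact ⟨le_rfl, fun k hk _ => h.g_c_lt_v k hk, fun h0 => absurd h0 (by omega)⟩
  | succ j ih =>
    obtain ⟨hv, hg, -⟩ := ih (by omega)
    have hs : j + 1 ∈ mkt.states := mem_states.2 ⟨by omega, hj⟩
    have hgj := hg _ hs (by omega)
    have hf := sub_pos.2 (c_lt_f h hs hgj hv)
    have hW1 := W_tail_pos h hα (by omega : 1 ≤ j + 1)
    have hW2 := W_tail_pos h hα (by omega : 1 ≤ j + 1 + 1)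
    have hpos := div_pos (mul_pos hf hW1) hW2
    have hc := h.c_nonneg
    have hle : (mkt.f (j + 1) (mkt.L α j) - mkt.c) * mkt.W (mkt.tail α (j + 1)) /
        mkt.W (mkt.tail α (j + 1 + 1)) ≤ mkt.f (j + 1) (mkt.L α j) - mkt.c := by
      rw [div_le_iff₀ hW2]
      exact mul_le_mul_of_nonneg_left (W_tail_le h hα hs) hf.le
    have hL : mkt.L α (j + 1) ≤ mkt.L α j := by
      rw [L_eq (by omega)]
      refine ((h.g_strictMono _ hs).monotoneOn (a := _) ?_ ?_ (le_sub_iff_add_le.1 hle)).trans_eq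
        (g_f (mem_penalties h hs hgj.le hv))
      · exact (add_pos_of_pos_of_nonneg hpos hc).le
      · exact f_nonneg (mem_penalties h hs hgj.le hv)
    refine ⟨hL.trans hv, fun k hk hjk => (g_c_antitone h hs hk hjk).trans_lt ?_, fun _ => hL⟩
    rw [L_eq (by omega)]
    exact h.g_strictMono _ hs hc (add_pos_of_pos_of_nonneg hpos hc).le (lt_add_of_pos_left _ hpos)

theorem L_le_v (h : mkt.IsStandard) (hα : mkt.IsLoad α) {j : ℕ} (hj : j ≤ mkt.n) :
    mkt.L α j ≤ mkt.v :=
  (L_bounds h hα hj).1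

theorem g_c_lt_L (h : mkt.IsStandard) (hα : mkt.IsLoad α) {j k : ℕ} (hk : k ∈ mkt.states)
    (hjk : j ≤ k) : mkt.g k mkt.c < mkt.L α j :=
  (L_bounds h hα (hjk.trans (mem_states.1 hk).2)).2.1 k hk hjk

theorem L_antitone (h : mkt.IsStandard) (hα : mkt.IsLoad α) {i j : ℕ} (hij : i ≤ j)
    (hj : j ≤ mkt.n) : mkt.L α j ≤ mkt.L α i := by
  induction j, hij using Nat.le_induction with
  | base => exact le_rfl
  | succ k hk ih => exact ((L_bounds h hα hj).2.2 (by omega)).trans (ih (by omega))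

theorem L_mem_penalties (h : mkt.IsStandard) (hα : mkt.IsLoad α) {j k : ℕ} (hk : k ∈ mkt.states)
    (hjk : j ≤ k) : mkt.L α j ∈ mkt.penalties k :=
  mem_penalties h hk (g_c_lt_L h hα hk hjk).le (L_le_v h hα (hjk.trans (mem_states.1 hk).2))

theorem p_sub_c (α : ℕ → ℝ) (j : ℕ) :
    mkt.p α j - mkt.c = (mkt.f j (mkt.L α (j - 1)) - mkt.c) * mkt.W (mkt.tail α j) := by
  simp [p]

theorem c_lt_f_L (h : mkt.IsStandard) (hα : mkt.IsLoad α) {j k : ℕ} (hk : k ∈ mkt.states)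
    (hjk : j ≤ k) : mkt.c < mkt.f k (mkt.L α j) :=
  c_lt_f h hk (g_c_lt_L h hα hk hjk) (L_le_v h hα (hjk.trans (mem_states.1 hk).2))

theorem p_sub_c_pos (h : mkt.IsStandard) (hα : mkt.IsLoad α) {j : ℕ} (hj : j ∈ mkt.states) :
    0 < mkt.p α j - mkt.c := by
  rw [p_sub_c]
  exact mul_pos (sub_pos.2 (c_lt_f_L h hα hj (by omega))) (W_tail_pos h hα (mem_states.1 hj).1)

theorem f_L_sub_c (h : mkt.IsStandard) (hα : mkt.IsLoad α) {j : ℕ} (hj : j ∈ mkt.states) :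
    mkt.f j (mkt.L α j) - mkt.c = (mkt.p α j - mkt.c) / mkt.W (mkt.tail α (j + 1)) := by
  have hpos := div_pos (p_sub_c_pos h hα hj) (W_tail_pos h hα (by omega : 1 ≤ j + 1))
  have hc := h.c_nonneg
  rw [p_sub_c] at hpos ⊢
  rw [L_eq (mem_states.1 hj).1, f_g h hj (by linarith), add_sub_cancel_right]

theorem f_L_pred_sub_c (h : mkt.IsStandard) (hα : mkt.IsLoad α) {j : ℕ} (hj : j ∈ mkt.states) :
    mkt.f j (mkt.L α (j - 1)) - mkt.c = (mkt.p α j - mkt.c) / mkt.W (mkt.tail α j) := by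
  rw [p_sub_c, mul_div_cancel_right₀ _ (W_tail_pos h hα (mem_states.1 hj).1).ne']

theorem mem_penalties_of_mem_Icc (h : mkt.IsStandard) (hα : mkt.IsLoad α) {j : ℕ}
    (hj : j ∈ mkt.states) {x : ℝ} (hx : x ∈ Set.Icc (mkt.L α j) (mkt.L α (j - 1))) :
    mkt.g j mkt.c < x ∧ x ≤ mkt.v ∧ x ∈ mkt.penalties j := by
  have h1 := (g_c_lt_L h hα hj le_rfl).trans_le hx.1
  have h2 := hx.2.trans (L_le_v h hα (by have := (mem_states.1 hj).2; omega))
  exact ⟨h1, h2, mem_penalties h hj h1.le h2⟩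

theorem level_mem_Icc (h : mkt.IsStandard) (hα : mkt.IsLoad α) {j : ℕ} (hj : j ∈ mkt.states)
    {x : ℝ} (hx : x ∈ Set.Icc (mkt.L α j) (mkt.L α (j - 1))) :
    (mkt.f j x - mkt.p α j) / (mkt.f j x - mkt.c) ∈ Set.Icc (0 : ℝ) 1 := by
  obtain ⟨hgx, hxv, hxp⟩ := mem_penalties_of_mem_Icc h hα hj hx
  have hf := sub_pos.2 (c_lt_f h hj hgx hxv)
  have hp := p_sub_c_pos h hα hj
  have hfL := (strictMonoOn_f h hj).monotoneOn (L_mem_penalties h hα hj le_rfl) hxp hx.1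
  have hW := W_tail_pos h hα (by omega : 1 ≤ j + 1)
  have hW1 := W_le_one h (tail_mem h hα (by omega : 1 ≤ j + 1))
  have heq := f_L_sub_c h hα hj
  have : mkt.p α j - mkt.c ≤ (mkt.p α j - mkt.c) / mkt.W (mkt.tail α (j + 1)) :=
    le_div_self hp.le hW hW1
  exact ⟨div_nonneg (by linarith) hf.le, (div_le_one hf).2 (by linarith)⟩

theorem phi_of_mem {j : ℕ} {x : ℝ} (hαj : α j ≠ 0)
    (hx : x ∈ Set.Icc (mkt.L α j) (mkt.L α (j - 1))) :
    α j * mkt.phi α j x + mkt.tail α (j + 1) =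
      mkt.wInv ((mkt.f j x - mkt.p α j) / (mkt.f j x - mkt.c)) := by
  rw [phi, if_neg hx.1.not_gt, if_pos hx.2]
  field_simp
  ring

theorem profit_mul_W_phi (h : mkt.IsStandard) (hα : mkt.IsLoad α) {j : ℕ} (hj : j ∈ mkt.states)
    {x : ℝ} (hx : x ∈ Set.Icc (mkt.L α j) (mkt.L α (j - 1))) :
    (mkt.f j x - mkt.c) * mkt.W (α j * mkt.phi α j x + mkt.tail α (j + 1)) =
      mkt.p α j - mkt.c := by
  obtain ⟨hgx, hxv, -⟩ := mem_penalties_of_mem_Icc h hα hj hx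
  have hf := sub_pos.2 (c_lt_f h hj hgx hxv)
  -- Without load in state `j` the interval shrinks to a point, and the factor `α j` removes the
  -- meaningless value of `phi`.
  by_cases hαj : α j = 0
  · have htail : mkt.tail α j = mkt.tail α (j + 1) := by
      rw [tail_eq_add (mem_states.1 hj).2, hαj, zero_add]
    have hW := W_tail_pos h hα (by omega : 1 ≤ j + 1)
    have hxL : x = mkt.L α (j - 1) := by
      refine le_antisymm hx.2 (le_trans (le_of_eq ?_) hx.1)
      refine (strictMonoOn_f h hj).injOn (L_mem_penalties h hα hj (by omega))
        (L_mem_penalties h hα hj le_rfl) (sub_left_injective (b := mkt.c) ?_)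
      simp only
      rw [f_L_sub_c h hα hj, f_L_pred_sub_c h hα hj, htail]
    rw [hαj, zero_mul, zero_add, hxL, ← htail, p_sub_c]
  · rw [phi_of_mem hαj hx, W, w_wInv h (level_mem_Icc h hα hj hx)]
    field_simp
    ring

theorem phi_of_le_L (h : mkt.IsStandard) (hα : mkt.IsLoad α) {j : ℕ} (hj : j ∈ mkt.states)
    (hαj : α j ≠ 0) {x : ℝ} (hx : x ≤ mkt.L α j) : mkt.phi α j x = 0 := by
  rcases hx.lt_or_eq with hlt | rfl
  · rw [phi, if_pos hlt]
  have hmem : mkt.L α j ∈ Set.Icc (mkt.L α j) (mkt.L α (j - 1)) :=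
    ⟨le_rfl, L_antitone h hα (by omega) (mem_states.1 hj).2⟩
  have hX := phi_of_mem hαj hmem
  have hXm := wInv_mem h (level_mem_Icc h hα hj hmem)
  have hW := profit_mul_W_phi h hα hj hmem
  have hWt := W_tail_pos h hα (by omega : 1 ≤ j + 1)
  have hf := f_L_sub_c h hα hj
  rw [eq_div_iff hWt.ne'] at hf
  rw [hX, ← hf] at hW
  have := (strictAntiOn_W h).injOn hXm (tail_mem h hα (by omega : 1 ≤ j + 1))
    (mul_left_cancel₀ (sub_pos.2 (c_lt_f_L h hα hj le_rfl)).ne' hW)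
  have h0 : α j * mkt.phi α j (mkt.L α j) = 0 := by linarith
  exact (mul_eq_zero.1 h0).resolve_left hαj

theorem phi_of_L_pred_le (h : mkt.IsStandard) (hα : mkt.IsLoad α) {j : ℕ} (hj : j ∈ mkt.states)
    (hαj : α j ≠ 0) {x : ℝ} (hx : mkt.L α (j - 1) ≤ x) : mkt.phi α j x = 1 := by
  have hLL := L_antitone h hα (j.sub_le 1) (mem_states.1 hj).2
  rcases hx.lt_or_eq with hlt | rfl
  · rw [phi, if_neg (by linarith), if_neg (by linarith)]
  have hmem : mkt.L α (j - 1) ∈ Set.Icc (mkt.L α j) (mkt.L α (j - 1)) := ⟨hLL, le_rfl⟩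
  have hX := phi_of_mem hαj hmem
  have hXm := wInv_mem h (level_mem_Icc h hα hj hmem)
  have hW := profit_mul_W_phi h hα hj hmem
  rw [hX, p_sub_c] at hW
  have := (strictAntiOn_W h).injOn hXm (tail_mem h hα (mem_states.1 hj).1)
    (mul_left_cancel₀ (sub_pos.2 (c_lt_f_L h hα hj (by omega))).ne' hW)
  rw [tail_eq_add (mem_states.1 hj).2] at this
  have h0 : α j * mkt.phi α j (mkt.L α (j - 1)) = α j * 1 := by linarith
  exact mul_left_cancel₀ hαj h0

/-- A distribution function that attains every value in [0, 1] cannot jump; this replaces a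
continuity proof when atoms are excluded later. -/
theorem exists_phi_eq (h : mkt.IsStandard) (hα : mkt.IsLoad α) {j : ℕ} (hj : j ∈ mkt.states)
    (hαj : α j ≠ 0) {u : ℝ} (hu : u ∈ Set.Icc (0 : ℝ) 1) : ∃ x, mkt.phi α j x = u := by
  obtain ⟨hj1, hjn⟩ := mem_states.1 hj
  have hα0 := (hα j hj).1
  have htail := tail_eq_add hjn α
  set T := α j * u + mkt.tail α (j + 1) with hT
  have hT1 : mkt.tail α (j + 1) ≤ T := by
    have := mul_nonneg hα0 hu.1
    linarith
  have hT2 : T ≤ mkt.tail α j := by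
    have := mul_le_mul_of_nonneg_left hu.2 hα0
    linarith
  have ht1 := tail_mem h hα hj1
  have ht2 := tail_mem h hα (by omega : 1 ≤ j + 1)
  have hTm : T ∈ Set.Icc (0 : ℝ) 1 := ⟨ht2.1.trans hT1, hT2.trans ht1.2⟩
  have hW1 := (strictAntiOn_W h).antitoneOn ht2 hTm hT1
  have hW2 := (strictAntiOn_W h).antitoneOn hTm ht1 hT2
  have hWp := W_tail_pos h hα hj1
  have hWT := hWp.trans_le hW2
  have hp := p_sub_c_pos h hα hj
  have hc := h.c_nonneg
  have hd := div_pos hp hWT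
  -- The penalty sought is the one at which the constant profit `p α j - c` is reached when the
  -- competing load is `T`.
  have hfx := f_g h hj (p := (mkt.p α j - mkt.c) / mkt.W T + mkt.c) (by linarith)
  have hxm : mkt.g j ((mkt.p α j - mkt.c) / mkt.W T + mkt.c) ∈ mkt.penalties j :=
    ⟨_, (by linarith : 0 ≤ (mkt.p α j - mkt.c) / mkt.W T + mkt.c), rfl⟩
  set x := mkt.g j ((mkt.p α j - mkt.c) / mkt.W T + mkt.c)
  have hx : x ∈ Set.Icc (mkt.L α j) (mkt.L α (j - 1)) := by
    constructor
    · rw [← (strictMonoOn_f h hj).le_iff_le (L_mem_penalties h hα hj le_rfl) hxm, hfx,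
        ← sub_le_iff_le_add, f_L_sub_c h hα hj]
      exact div_le_div_of_nonneg_left hp.le hWT hW1
    · rw [← (strictMonoOn_f h hj).le_iff_le hxm (L_mem_penalties h hα hj (by omega)), hfx,
        ← le_sub_iff_add_le, f_L_pred_sub_c h hα hj]
      exact div_le_div_of_nonneg_left hp.le hWp hW2
  have hlev : (mkt.f j x - mkt.p α j) / (mkt.f j x - mkt.c) = mkt.w T := by
    have hw : mkt.w T = 1 - mkt.W T := by simp [W]
    rw [hfx, hw, add_sub_cancel_right, div_eq_iff hd.ne']
    field_simp
    ring
  have hphi := phi_of_mem hαj hx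
  rw [hlev, wInv_w h hTm, hT] at hphi
  exact ⟨x, mul_left_cancel₀ hαj (by linarith)⟩

/-- The probability that a penalty of at most `x` is offered at a node where a channel of state
`k` is offered with probability `α k` and with the penalty distribution `phi α k`. -/
noncomputable def offerCdf (mkt : Market) (α : ℕ → ℝ) (x : ℝ) : ℝ := ∑ k ∈ mkt.states, α k * mkt.phi α k x

/-- The intervals are stacked with higher states lower down: at a penalty in the interval of `j`,
higher states have offered all their mass and lower states none. -/
theorem offerCdf_of_mem (h : mkt.IsStandard) (hα : mkt.IsLoad α) {j : ℕ} (hj : j ∈ mkt.states)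
    {x : ℝ} (hx : x ∈ Set.Icc (mkt.L α j) (mkt.L α (j - 1))) :
    mkt.offerCdf α x = α j * mkt.phi α j x + mkt.tail α (j + 1) := by
  obtain ⟨hj1, hjn⟩ := mem_states.1 hj
  have h1 : mkt.offerCdf α x = mkt.tail (fun k => α k * mkt.phi α k x) j := by
    refine (Finset.sum_subset (Finset.Icc_subset_Icc_left hj1) fun k hk hkj => ?_).symm
    by_cases hαk : α k = 0
    · rw [hαk, zero_mul]
    have hkj' : k ≤ j - 1 := by
      simp only [Finset.mem_Icc] at hk hkj
      omega
    rw [phi_of_le_L h hα hk hαk (hx.2.trans (L_antitone h hα hkj' (by omega))), mul_zero]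
  rw [h1, tail_eq_add hjn]
  congr 1
  refine Finset.sum_congr rfl fun k hk => ?_
  beta_reduce
  have hks := mem_states_of_mem_Icc (by omega) hk
  by_cases hαk : α k = 0
  · rw [hαk, zero_mul]
  have := Finset.mem_Icc.1 hk
  rw [phi_of_L_pred_le h hα hks hαk ((L_antitone h hα (by omega) (by omega)).trans hx.1), mul_one]

theorem profit_mul_W_offerCdf (h : mkt.IsStandard) (hα : mkt.IsLoad α) {j : ℕ}
    (hj : j ∈ mkt.states) {x : ℝ} (hx : x ∈ Set.Icc (mkt.L α j) (mkt.L α (j - 1))) :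
    (mkt.f j x - mkt.c) * mkt.W (mkt.offerCdf α x) = mkt.p α j - mkt.c := by
  rw [offerCdf_of_mem h hα hj hx, profit_mul_W_phi h hα hj hx]

theorem offerCdf_of_lt (h : mkt.IsStandard) (hα : mkt.IsLoad α) {x : ℝ}
    (hx : x < mkt.L α mkt.n) : mkt.offerCdf α x = 0 := by
  refine Finset.sum_eq_zero fun k hk => ?_
  by_cases hαk : α k = 0
  · rw [hαk, zero_mul]
  rw [phi_of_le_L h hα hk hαk (hx.le.trans (L_antitone h hα (mem_states.1 hk).2 le_rfl)), mul_zero]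

theorem L_mem_Icc_self (h : mkt.IsStandard) (hα : mkt.IsLoad α) {j : ℕ} (hj : j ∈ mkt.states) :
    mkt.L α j ∈ Set.Icc (mkt.L α j) (mkt.L α (j - 1)) :=
  ⟨le_rfl, L_antitone h hα (by omega) (mem_states.1 hj).2⟩

theorem L_mem_Icc_succ (h : mkt.IsStandard) (hα : mkt.IsLoad α) {j : ℕ} (hj : j < mkt.n) :
    mkt.L α j ∈ Set.Icc (mkt.L α (j + 1)) (mkt.L α (j + 1 - 1)) :=
  ⟨L_antitone h hα (by omega) hj, le_rfl⟩

/-- On the interval of a state i > j, the profit of state i is constant, so that of state j is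
proportional to (f_j - c)/(f_i - c). By the ratio assumption this increases with the penalty, so
moving to the upper end-point does not lose. Repeating this leads up to the interval of `j` itself.
-/
theorem profit_le_of_lower (h : mkt.IsStandard) (hα : mkt.IsLoad α) {j : ℕ} (hj : j ∈ mkt.states)
    {i : ℕ} (hji : j ≤ i) (hi : i ≤ mkt.n) {x : ℝ}
    (hx : x ∈ Set.Icc (mkt.L α i) (mkt.L α (i - 1))) (hgx : mkt.g j mkt.c < x) :
    (mkt.f j x - mkt.c) * mkt.W (mkt.offerCdf α x) ≤ mkt.p α j - mkt.c := by
  induction i, hji using Nat.le_induction generalizing x with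
  | base => exact (profit_mul_W_offerCdf h hα hj hx).le
  | succ i hji ih =>
    have hj1 := (mem_states.1 hj).1
    have his : i + 1 ∈ mkt.states := mem_states.2 ⟨by omega, hi⟩
    have hxL : x ≤ mkt.L α i := hx.2
    have hLm := L_mem_Icc_succ h hα (Nat.lt_of_succ_le hi)
    have hIH := ih (by omega) (L_mem_Icc_self h hα (mem_states.2 ⟨by omega, by omega⟩))
      (hgx.trans_le hxL)
    have e1 := profit_mul_W_offerCdf h hα his hx
    have e2 := profit_mul_W_offerCdf h hα his hLm
    have hLv := L_le_v h hα (by omega : i ≤ mkt.n)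
    have hr := profit_mul_le h hj his (by omega) hgx hxL hLv
    have hp := p_sub_c_pos h hα his
    have ha : 0 < mkt.f (i + 1) x - mkt.c :=
      sub_pos.2 (c_lt_f h his (mem_penalties_of_mem_Icc h hα his hx).1 (hxL.trans hLv))
    have hb : 0 < mkt.f (i + 1) (mkt.L α i) - mkt.c := sub_pos.2 (c_lt_f_L h hα his (by omega))
    refine le_trans ?_ hIH
    rw [eq_div_of_mul_eq ha.ne' ((mul_comm _ _).trans e1),
      eq_div_of_mul_eq hb.ne' ((mul_comm _ _).trans e2), ← mul_div_assoc, ← mul_div_assoc,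
      div_le_div_iff₀ ha hb]
    nlinarith [mul_le_mul_of_nonneg_left hr hp.le]

/-- Mirror image of the previous argument: for i < j the quotient (f_j - c)/(f_i - c) decreases with
the penalty, so one descends through the lower end-points to the interval of `j`. -/
theorem profit_le_of_higher (h : mkt.IsStandard) (hα : mkt.IsLoad α) {j : ℕ} (hj : j ∈ mkt.states)
    {i : ℕ} (hi : 1 ≤ i) (hij : i ≤ j) {x : ℝ}
    (hx : x ∈ Set.Icc (mkt.L α i) (mkt.L α (i - 1))) :
    (mkt.f j x - mkt.c) * mkt.W (mkt.offerCdf α x) ≤ mkt.p α j - mkt.c := by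
  induction hij using Nat.decreasingInduction generalizing x with
  | self => exact (profit_mul_W_offerCdf h hα hj hx).le
  | of_succ i hij ih =>
    have hjn := (mem_states.1 hj).2
    have his : i ∈ mkt.states := mem_states.2 ⟨hi, by omega⟩
    have hLx : mkt.L α i ≤ x := hx.1
    have hLm := L_mem_Icc_self h hα his
    have hIH := ih (by omega) (L_mem_Icc_succ h hα (by omega))
    have e1 := profit_mul_W_offerCdf h hα his hx
    have e2 := profit_mul_W_offerCdf h hα his hLm
    obtain ⟨hgx, hxv, -⟩ := mem_penalties_of_mem_Icc h hα his hx
    have hr := profit_mul_le h his hj (by omega) (g_c_lt_L h hα his le_rfl) hLx hxv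
    have hp := p_sub_c_pos h hα his
    have ha : 0 < mkt.f i x - mkt.c := sub_pos.2 (c_lt_f h his hgx hxv)
    have hb : 0 < mkt.f i (mkt.L α i) - mkt.c := sub_pos.2 (c_lt_f_L h hα his le_rfl)
    refine le_trans ?_ hIH
    rw [eq_div_of_mul_eq ha.ne' ((mul_comm _ _).trans e1),
      eq_div_of_mul_eq hb.ne' ((mul_comm _ _).trans e2), ← mul_div_assoc, ← mul_div_assoc,
      div_le_div_iff₀ ha hb]
    nlinarith [mul_le_mul_of_nonneg_left hr hp.le]

theorem exists_mem_Icc_L {x : ℝ} (hx : mkt.L α mkt.n ≤ x) (hxv : x ≤ mkt.v) (hn : 1 ≤ mkt.n) :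
    ∃ i ∈ mkt.states, x ∈ Set.Icc (mkt.L α i) (mkt.L α (i - 1)) := by
  by_contra! hne
  have : ∀ i ≤ mkt.n, x ≤ mkt.L α i := by
    intro i
    induction i with
    | zero => exact fun _ => hxv
    | succ i ih =>
      intro hi
      by_contra! hlt
      exact hne (i + 1) (mem_states.2 ⟨by omega, hi⟩) ⟨hlt.le, ih (by omega)⟩
  exact hne mkt.n (mem_states.2 ⟨hn, le_rfl⟩) ⟨hx, this _ (by omega)⟩

theorem profit_mul_W_offerCdf_le (h : mkt.IsStandard) (hα : mkt.IsLoad α) {j : ℕ}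
    (hj : j ∈ mkt.states) {x : ℝ} (hx : x ∈ mkt.penalties j) (hxv : x ≤ mkt.v)
    (hF : mkt.offerCdf α x ∈ Set.Icc (0 : ℝ) 1) :
    (mkt.f j x - mkt.c) * mkt.W (mkt.offerCdf α x) ≤ mkt.p α j - mkt.c := by
  obtain ⟨hj1, hjn⟩ := mem_states.1 hj
  have hns : mkt.n ∈ mkt.states := mem_states.2 ⟨by omega, le_rfl⟩
  rcases le_or_gt x (mkt.g j mkt.c) with hle | hgx
  · have hf : mkt.f j x ≤ mkt.c := by
      have := (strictMonoOn_f h hj).monotoneOn hx ⟨mkt.c, h.c_nonneg, rfl⟩ hle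
      rwa [f_g h hj h.c_nonneg] at this
    exact (mul_nonpos_of_nonpos_of_nonneg (sub_nonpos.2 hf) (W_nonneg h hF)).trans
      (p_sub_c_pos h hα hj).le
  rcases lt_or_ge x (mkt.L α mkt.n) with hlt | hge
  -- Below `L n` nobody offers, but `L n` already wins with probability 1 and has a larger margin.
  · have hLn := L_mem_Icc_self h hα hns
    have key := profit_le_of_lower h hα hj hjn le_rfl hLn (hgx.trans hlt)
    have hW : mkt.W (mkt.offerCdf α (mkt.L α mkt.n)) = 1 := by
      have e := profit_mul_W_offerCdf h hα hns hLn
      have e' := f_L_sub_c h hα hns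
      rw [tail_of_lt (by omega), W_zero h, div_one] at e'
      rw [e'] at e
      exact mul_left_cancel₀ (p_sub_c_pos h hα hns).ne' (by linarith)
    rw [hW] at key
    rw [offerCdf_of_lt h hα hlt, W_zero h]
    have := (strictMonoOn_f h hj hx
      (mem_penalties h hj (hgx.trans hlt).le (L_le_v h hα le_rfl))) hlt
    linarith
  · obtain ⟨i, hi, hxi⟩ := exists_mem_Icc_L hge hxv (by omega)
    rcases le_total j i with hji | hij
    · exact profit_le_of_lower h hα hj hji (mem_states.1 hi).2 hxi hgx
    · exact profit_le_of_higher h hα hj (mem_states.1 hi).1 hij hxi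

end Market

end SpectrumMarket

/-! ### Comparison of two mean valid partitions. -/

namespace SpectrumMarket

namespace IsMeanValidPartition

variable {V : Type*} [Fintype V] [DecidableEq V] {G : SimpleGraph V} {d d' : ℕ}
  {I : Fin d → Finset V} {I' : Fin d' → Finset V}

theorem nonempty [Nonempty V] (hI : IsMeanValidPartition G I) (s : Fin d) : (I s).Nonempty := by
  by_contra hne
  rw [Finset.not_nonempty_iff_eq_empty] at hne
  obtain ⟨a⟩ := ‹Nonempty V›
  have := (hI.maximal s).2 (y := {a}) (by simp [SimpleGraph.IsIndepSet]) (by simp [hne])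
  simpa [hne] using this (Finset.mem_singleton_self a)

theorem card_pos [Nonempty V] (hI : IsMeanValidPartition G I) (s : Fin d) :
    (0 : ℝ) < (I s).card :=
  Nat.cast_pos.2 (hI.nonempty s).card_pos

/-- The index of the part of the partition that contains the node `a`. -/
noncomputable def part (hI : IsMeanValidPartition G I) (a : V) : Fin d := (hI.cover a).choose

theorem mem_iff (hI : IsMeanValidPartition G I) {a : V} {s : Fin d} :
    a ∈ I s ↔ hI.part a = s := by
  have hp : a ∈ I (hI.part a) := (hI.cover a).choose_spec
  refine ⟨fun ha => ?_, fun hs => hs ▸ hp⟩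
  by_contra hne
  exact Finset.disjoint_left.1 (hI.disjoint _ _ hne) hp ha

theorem injective [Nonempty V] (hI : IsMeanValidPartition G I) : Function.Injective I := by
  intro s r hsr
  obtain ⟨a, ha⟩ := hI.nonempty s
  exact (hI.mem_iff.1 ha).symm.trans (hI.mem_iff.1 (hsr ▸ ha))

theorem sum_eq_sum_parts (hI : IsMeanValidPartition G I) (A : Finset V) (φ : V → ℝ) :
    ∑ a ∈ A, φ a = ∑ s, ∑ a ∈ A ∩ I s, φ a := by
  rw [← Finset.sum_fiberwise A hI.part φ]
  refine Finset.sum_congr rfl fun s _ => Finset.sum_congr ?_ fun _ _ => rfl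
  ext a
  simp [hI.mem_iff]

theorem sum_part (hI : IsMeanValidPartition G I) (A : Finset V) (u : Fin d → ℝ) :
    ∑ a ∈ A, u (hI.part a) = ∑ s, ((A ∩ I s).card : ℝ) * u s := by
  rw [hI.sum_eq_sum_parts]
  refine Finset.sum_congr rfl fun s _ => ?_
  rw [← nsmul_eq_mul, ← Finset.sum_const]
  exact Finset.sum_congr rfl fun a ha => by rw [hI.mem_iff.1 (Finset.mem_inter.1 ha).2]

theorem sum_over_part (hI : IsMeanValidPartition G I) (s : Fin d) (u : Fin d → ℝ) :
    ∑ a ∈ I s, u (hI.part a) = ((I s).card : ℝ) * u s := by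
  rw [← nsmul_eq_mul, ← Finset.sum_const]
  exact Finset.sum_congr rfl fun a ha => by rw [hI.mem_iff.1 ha]

theorem sum_univ_eq (hI : IsMeanValidPartition G I) (φ : V → ℝ) :
    ∑ a, φ a = ∑ s, ∑ a ∈ I s, φ a := by
  rw [hI.sum_eq_sum_parts]
  simp

theorem sum_inv_le_one (hI : IsMeanValidPartition G I) {A : Finset V}
    (hA : G.IsIndepSet (A : Set V)) : ∑ a ∈ A, ((I (hI.part a)).card : ℝ)⁻¹ ≤ 1 := by
  rw [hI.sum_part A fun s => ((I s).card : ℝ)⁻¹]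
  exact hI.sum_le_one A hA

theorem sum_inv_part [Nonempty V] (hI : IsMeanValidPartition G I) (s : Fin d) :
    ∑ a ∈ I s, ((I (hI.part a)).card : ℝ)⁻¹ = 1 := by
  rw [hI.sum_over_part s fun s => ((I s).card : ℝ)⁻¹]
  exact mul_inv_cancel₀ (hI.card_pos s).ne'

theorem sum_inv_univ [Nonempty V] (hI : IsMeanValidPartition G I) :
    ∑ a, ((I (hI.part a)).card : ℝ)⁻¹ = d := by
  rw [hI.sum_univ_eq]
  simp [hI.sum_inv_part]

/-- The weights 1/|part| sum to `d` over all nodes, and each of the `d'` parts of the other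
partition, being independent, carries at most 1. -/
theorem length_le [Nonempty V] (hI : IsMeanValidPartition G I) (hI' : IsMeanValidPartition G I') :
    d ≤ d' := by
  have h := hI'.sum_univ_eq fun a => ((I (hI.part a)).card : ℝ)⁻¹
  rw [hI.sum_inv_univ] at h
  have h2 := Finset.sum_le_sum fun r (_ : r ∈ Finset.univ) =>
    hI.sum_inv_le_one (hI'.maximal r).1
  rw [← h] at h2
  simpa using h2

/-- Equality of the numbers of parts forces equality in each of the bounds by 1. -/
theorem sum_inv_other_part [Nonempty V] (hI : IsMeanValidPartition G I)
    (hI' : IsMeanValidPartition G I') (r : Fin d') :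
    ∑ a ∈ I' r, ((I (hI.part a)).card : ℝ)⁻¹ = 1 := by
  have hd : d = d' := le_antisymm (hI.length_le hI') (hI'.length_le hI)
  have h := hI'.sum_univ_eq fun a => ((I (hI.part a)).card : ℝ)⁻¹
  rw [hI.sum_inv_univ] at h
  refine (Finset.sum_eq_sum_iff_of_le fun r (_ : r ∈ Finset.univ) =>
    hI.sum_inv_le_one (hI'.maximal r).1).1 ?_ r (Finset.mem_univ r)
  rw [← h, hd]
  simp

theorem sum_inv_mul_inv [Nonempty V] (hI : IsMeanValidPartition G I)
    (hI' : IsMeanValidPartition G I') :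
    ∑ a, ((I (hI.part a)).card : ℝ)⁻¹ * ((I' (hI'.part a)).card : ℝ)⁻¹ =
      ∑ a, ((I' (hI'.part a)).card : ℝ)⁻¹ * ((I' (hI'.part a)).card : ℝ)⁻¹ := by
  rw [hI'.sum_univ_eq, hI'.sum_univ_eq fun a =>
    ((I' (hI'.part a)).card : ℝ)⁻¹ * ((I' (hI'.part a)).card : ℝ)⁻¹]
  refine Finset.sum_congr rfl fun r _ => ?_
  have key : ∀ φ : V → ℝ, ∑ a ∈ I' r, φ a * ((I' (hI'.part a)).card : ℝ)⁻¹ =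
      (∑ a ∈ I' r, φ a) * ((I' r).card : ℝ)⁻¹ := fun φ => by
    rw [Finset.sum_mul]
    exact Finset.sum_congr rfl fun a ha => by rw [hI'.mem_iff.1 ha]
  rw [key, key, hI.sum_inv_other_part hI', hI'.sum_inv_part]

/-- `sum_inv_mul_inv` in both directions makes the sum of squared differences of the two weights
vanish. -/
theorem card_part_eq [Nonempty V] (hI : IsMeanValidPartition G I)
    (hI' : IsMeanValidPartition G I') (a : V) :
    (I (hI.part a)).card = (I' (hI'.part a)).card := by
  have h1 := hI.sum_inv_mul_inv hI'
  have h2 := hI'.sum_inv_mul_inv hI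
  have h0 : ∑ a, (((I (hI.part a)).card : ℝ)⁻¹ - ((I' (hI'.part a)).card : ℝ)⁻¹) ^ 2 = 0 := by
    have : ∀ a, (((I (hI.part a)).card : ℝ)⁻¹ - ((I' (hI'.part a)).card : ℝ)⁻¹) ^ 2 =
        (((I (hI.part a)).card : ℝ)⁻¹ * ((I (hI.part a)).card : ℝ)⁻¹ -
          ((I' (hI'.part a)).card : ℝ)⁻¹ * ((I (hI.part a)).card : ℝ)⁻¹) +
        (((I' (hI'.part a)).card : ℝ)⁻¹ * ((I' (hI'.part a)).card : ℝ)⁻¹ -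
          ((I (hI.part a)).card : ℝ)⁻¹ * ((I' (hI'.part a)).card : ℝ)⁻¹) := fun a => by ring
    simp only [this, Finset.sum_add_distrib, Finset.sum_sub_distrib]
    linarith
  have := (Finset.sum_eq_zero_iff_of_nonneg fun a _ => sq_nonneg _).1 h0 a (Finset.mem_univ a)
  exact_mod_cast inv_injective (sub_eq_zero.1 (pow_eq_zero_iff two_ne_zero |>.1 this))

/-- Double counting of the nodes that lie in parts of size `k`. The right side depends only on part
sizes at nodes, which the two partitions share. -/
theorem card_filter_mul [Nonempty V] (hI : IsMeanValidPartition G I) (k : ℕ) :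
    (Finset.univ.filter fun s => k = (I s).card).card * k =
      (Finset.univ.filter fun a => k = (I (hI.part a)).card).card := by
  rw [Finset.card_eq_sum_card_fiberwise (f := hI.part)
    (t := Finset.univ.filter fun s => k = (I s).card) (by intro a; simp),
    Finset.sum_const_nat]
  intro s hs
  rw [Finset.mem_filter] at hs
  rw [hs.2]
  congr 1
  ext a
  simp only [Finset.mem_filter, Finset.mem_univ, true_and, hI.mem_iff]
  exact ⟨fun h => h.2, fun h => ⟨by rw [h], h⟩⟩

theorem map_card_eq [Nonempty V] (hI : IsMeanValidPartition G I)
    (hI' : IsMeanValidPartition G I') :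
    (Finset.univ.val.map fun s => (I s).card) = Finset.univ.val.map fun s => (I' s).card := by
  ext k
  rw [Multiset.count_map, Multiset.count_map, ← Finset.filter_val, ← Finset.filter_val,
    ← Finset.card_def, ← Finset.card_def]
  -- The double count carries no information for `k = 0`; there both multiplicities vanish since
  -- parts are nonempty.
  rcases k.eq_zero_or_pos with rfl | hk
  · have h1 : ∀ s, 0 ≠ (I s).card := fun s => (hI.nonempty s).card_pos.ne
    have h2 : ∀ s, 0 ≠ (I' s).card := fun s => (hI'.nonempty s).card_pos.ne
    simp only [h1, h2, Finset.filter_false, Finset.card_empty]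
  · refine Nat.eq_of_mul_eq_mul_right hk ?_
    rw [hI.card_filter_mul, hI'.card_filter_mul]
    simp only [hI.card_part_eq hI']

theorem card_eq [Nonempty V] {I' : Fin d → Finset V} (hI : IsMeanValidPartition G I)
    (hI' : IsMeanValidPartition G I') (s : Fin d) : (I s).card = (I' s).card := by
  have h := hI.map_card_eq hI'
  rw [Fin.univ_val_map, Fin.univ_val_map, Multiset.coe_eq_coe] at h
  have hs : ∀ {J : Fin d → Finset V}, IsMeanValidPartition G J →
      (List.ofFn fun s => (J s).card).SortedGE := fun hJ =>
    List.sortedGE_ofFn_iff.2 fun s r hsr => hJ.card_antitone s r hsr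
  exact congrFun (List.ofFn_injective (h.eq_of_sortedGE (hs hI) (hs hI'))) s

theorem disjoint_of_card_ne [Nonempty V] (hI : IsMeanValidPartition G I)
    (hI' : IsMeanValidPartition G I') {s : Fin d} {r : Fin d'}
    (hne : (I s).card ≠ (I' r).card) : Disjoint (I s) (I' r) := by
  refine Finset.disjoint_left.2 fun a ha ha' => hne ?_
  rw [← hI.mem_iff.1 ha, ← hI'.mem_iff.1 ha', hI.card_part_eq hI']

end IsMeanValidPartition

/-! ### Uniqueness of the selection probabilities and the profit of a part. -/

/-- The probabilities `t` distribute the additional load `q` among nodes of weights `M` and loads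
`b` so that the values `M s * W (q * t s + b s)` are at most `lam`, with equality where `t s` is
positive. -/
structure IsShare {d : ℕ} (W : ℝ → ℝ) (q : ℝ) (M b t : Fin d → ℝ) (lam : ℝ) : Prop where
  nonneg : ∀ s, 0 ≤ t s
  sum_eq_one : ∑ s, t s = 1
  mem : ∀ s, q * t s + b s ∈ Set.Icc (0 : ℝ) 1
  le : ∀ s, M s * W (q * t s + b s) ≤ lam
  eq : ∀ s, 0 < t s → M s * W (q * t s + b s) = lam

namespace IsShare

variable {d : ℕ} {W : ℝ → ℝ} {q : ℝ} {M M' b b' t t' : Fin d → ℝ} {lam lam' : ℝ}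

/-- If the level of `t'` were higher, every coordinate used by `t'` would need a strictly larger
share under `t`, although both have total mass 1. -/
theorem level_le (hW : StrictAntiOn W (Set.Icc 0 1)) (hq : 0 < q) (hM : ∀ s, 0 < M s)
    (h : IsShare W q M b t lam) (h' : IsShare W q M b t' lam') : lam' ≤ lam := by
  by_contra! hlt
  have hlt' : ∀ s, 0 < t' s → t' s < t s := fun s hs => by
    have h1 : M s * W (q * t s + b s) < M s * W (q * t' s + b s) :=
      (h.le s).trans_lt (hlt.trans_eq (h'.eq s hs).symm)
    have h2 := (hW.lt_iff_gt (h.mem s) (h'.mem s)).1 (lt_of_mul_lt_mul_left h1 (hM s).le)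
    exact lt_of_mul_lt_mul_left (by linarith) hq.le
  have hle : ∀ s ∈ Finset.univ, t' s ≤ t s := fun s _ => by
    rcases (h'.nonneg s).eq_or_lt with h0 | hpos
    · rw [← h0]
      exact h.nonneg s
    · exact (hlt' s hpos).le
  have heq := (Finset.sum_eq_sum_iff_of_le hle).1 (h'.sum_eq_one.trans h.sum_eq_one.symm)
  have hzero : ∀ s, t' s = 0 := fun s => by
    by_contra hne
    have hpos := (h'.nonneg s).lt_of_ne' hne
    exact (hlt' s hpos).ne (heq s (Finset.mem_univ s))
  have := h'.sum_eq_one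
  simp [hzero] at this

theorem le_of_weight_eq (hW : StrictAntiOn W (Set.Icc 0 1)) (hq : 0 < q)
    (h : IsShare W q M b t lam) (h' : IsShare W q M' b' t' lam) {s r : Fin d} (hM : 0 < M s)
    (hMM : M s = M' r) (hb : b s = b' r) : t s ≤ t' r := by
  rcases (h.nonneg s).eq_or_lt with h0 | hpos
  · rw [← h0]
    exact h'.nonneg r
  have h1 := h'.le r
  rw [← h.eq s hpos, ← hMM, mul_le_mul_iff_right₀ hM, hW.le_iff_ge (h'.mem r) (h.mem s), hb,
    add_le_add_iff_right, mul_le_mul_iff_right₀ hq] at h1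
  exact h1

end IsShare

variable {V : Type*} {mkt : Market} {d : ℕ} {I I' : Fin d → Finset V} {t t' : Fin d → ℕ → ℝ}

/-- The probabilities with which channels are offered at the nodes of a part of a partition that
is selected with probability `τ k` in state `k`. -/
abbrev partLoad (mkt : Market) (τ : ℕ → ℝ) : ℕ → ℝ := fun k => mkt.q k * τ k

namespace IsSelection

theorem of_card_eq (ht : IsSelection mkt I t) (hcard : ∀ s, (I s).card = (I' s).card) :
    IsSelection mkt I' t := by
  simpa only [IsSelection, hcard] using ht

theorem nonneg (ht : IsSelection mkt I t) {j : ℕ} (hj : j ∈ mkt.states) (s : Fin d) :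
    0 ≤ t s j := by
  obtain ⟨-, dj, -, -, hpos, hzero, -⟩ := ht j hj
  rcases lt_or_ge (s : ℕ) dj with hs | hs
  · exact (hpos s hs).le
  · exact (hzero s hs).ge

theorem isLoad (h : mkt.IsStandard) (ht : IsSelection mkt I t) (s : Fin d) :
    mkt.IsLoad (partLoad mkt (t s)) := by
  intro k hk
  have hq := h.q_pos k hk
  refine ⟨mul_nonneg hq.le (ht.nonneg hk s), mul_le_of_le_one_right hq.le ?_⟩
  rw [← (ht k hk).1]
  exact Finset.single_le_sum (fun r _ => ht.nonneg hk r) (Finset.mem_univ s)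

/-- The common value of `|I s| * W (γ s j)` for the parts used in state `j`. -/
theorem exists_level (ht : IsSelection mkt I t) {j : ℕ} (hj : j ∈ mkt.states) (o : Fin d)
    (ho : (o : ℕ) = 0) :
    0 < t o j ∧ (∀ s, ((I s).card : ℝ) * mkt.W (mkt.tail (partLoad mkt (t s)) j) ≤
      ((I o).card : ℝ) * mkt.W (mkt.tail (partLoad mkt (t o)) j)) ∧
    ∀ s, 0 < t s j → ((I s).card : ℝ) * mkt.W (mkt.tail (partLoad mkt (t s)) j) =
      ((I o).card : ℝ) * mkt.W (mkt.tail (partLoad mkt (t o)) j) := by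
  obtain ⟨-, dj, hdj, -, hpos, hzero, heq, hanti⟩ := ht j hj
  refine ⟨hpos o (by omega), fun s => hanti o s (Fin.le_def.2 (by omega)), fun s hs => ?_⟩
  refine heq s o ?_ (by omega)
  by_contra hge
  exact hs.ne' (hzero s (not_lt.1 hge))

theorem isShare (h : mkt.IsStandard) (ht : IsSelection mkt I t) {j : ℕ} (hj : j ∈ mkt.states)
    (o : Fin d) (ho : (o : ℕ) = 0) :
    IsShare mkt.W (mkt.q j) (fun s => ((I s).card : ℝ))
      (fun s => mkt.tail (partLoad mkt (t s)) (j + 1)) (fun s => t s j)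
      (((I o).card : ℝ) * mkt.W (mkt.tail (partLoad mkt (t o)) j)) := by
  obtain ⟨hj1, hjn⟩ := Market.mem_states.1 hj
  have htail : ∀ s, mkt.q j * t s j + mkt.tail (partLoad mkt (t s)) (j + 1) =
      mkt.tail (partLoad mkt (t s)) j := fun s =>
    (Market.tail_eq_add hjn (partLoad mkt (t s))).symm
  obtain ⟨-, hle, heq⟩ := ht.exists_level hj o ho
  refine ⟨ht.nonneg hj, (ht j hj).1, fun s => ?_, fun s => ?_, fun s hs => ?_⟩
  · rw [htail]
    exact Market.tail_mem h (ht.isLoad h s) hj1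
  · rw [htail]
    exact hle s
  · rw [htail]
    exact heq s hs

theorem eq_of_card_eq (h : mkt.IsStandard) (ht : IsSelection mkt I t)
    (ht' : IsSelection mkt I' t') (hcard : ∀ s, (I s).card = (I' s).card)
    (hpos : ∀ s, (0 : ℝ) < (I s).card) {j : ℕ} (hj : j ∈ mkt.states) {s r : Fin d}
    (hsr : (I s).card = (I' r).card) : t s j = t' r j := by
  obtain ⟨hj1, hjn⟩ := Market.mem_states.1 hj
  -- The claim covers all states from `i` upwards, because the loads entering state `i` are tails
  -- over all higher states.
  have key : ∀ i ≤ mkt.n + 1, 1 ≤ i → ∀ k, i ≤ k → k ≤ mkt.n → ∀ s r,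
      (I s).card = (I' r).card → t s k = t' r k := by
    intro i hi
    induction hi using Nat.decreasingInduction with
    | self => exact fun _ k h1 h2 => absurd h2 (by omega)
    | of_succ i hi ih =>
      intro hi1 k hik hkn
      rcases hik.eq_or_lt with rfl | hik
      swap
      · exact ih (by omega) k hik hkn
      have hk : i ∈ mkt.states := Market.mem_states.2 ⟨hi1, hkn⟩
      have hb : ∀ s r, (I s).card = (I' r).card →
          mkt.tail (partLoad mkt (t s)) (i + 1) = mkt.tail (partLoad mkt (t' r)) (i + 1) :=
        fun s r hsr => Finset.sum_congr rfl fun k hk => by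
          have := Finset.mem_Icc.1 hk
          simp only [partLoad]
          rw [ih (by omega) k this.1 this.2 s r hsr]
      intro s r hsr
      have hd : 0 < d := s.pos
      have hS := ht.isShare h hk ⟨0, hd⟩ rfl
      have hS' := ht'.isShare h hk ⟨0, hd⟩ rfl
      have hM : (fun s => ((I' s).card : ℝ)) = fun s => ((I s).card : ℝ) :=
        funext fun s => by rw [hcard]
      have hB : (fun s => mkt.tail (partLoad mkt (t' s)) (i + 1)) =
          fun s => mkt.tail (partLoad mkt (t s)) (i + 1) :=
        funext fun s => (hb s s (hcard s)).symm
      have hW := Market.strictAntiOn_W h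
      have hq := h.q_pos i hk
      -- Levels are compared index by index, with the weights and loads of the two selections
      -- identified; the shares are compared afterwards across possibly different indices `s` and
      -- `r`.
      have hS2 := hS'
      rw [hM, hB] at hS2
      have hlam := le_antisymm (IsShare.level_le hW hq hpos hS2 hS)
        (IsShare.level_le hW hq hpos hS hS2)
      rw [← hlam] at hS'
      have hsr' : ((I s).card : ℝ) = (I' r).card := by rw [hsr]
      exact le_antisymm (hS.le_of_weight_eq hW hq hS' (hpos s) hsr' (hb s r hsr))
        (hS'.le_of_weight_eq hW hq hS (hsr' ▸ hpos s) hsr'.symm (hb s r hsr).symm)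
  exact key j (by omega) hj1 j le_rfl hjn s r hsr

/-- The supports are nested. If part `s` were dropped in state `j`, its load would stay fixed while
that of the first part grows strictly; `s`, level with the first part in state `j + 1`, would then
exceed the maximum in state `j`. -/
theorem pos_of_pos_succ (h : mkt.IsStandard) (ht : IsSelection mkt I t)
    (hpos : ∀ s, (0 : ℝ) < (I s).card) {j : ℕ} (hj : j ∈ mkt.states)
    (hj' : j + 1 ∈ mkt.states) {s : Fin d} (hs : 0 < t s (j + 1)) : 0 < t s j := by
  obtain ⟨hj1, hjn⟩ := Market.mem_states.1 hj
  refine (ht.nonneg hj s).lt_of_ne' fun h0 => ?_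
  let o : Fin d := ⟨0, s.pos⟩
  obtain ⟨ho, hle, -⟩ := ht.exists_level hj o rfl
  obtain ⟨-, -, heq⟩ := ht.exists_level hj' o rfl
  have e1 := Market.tail_eq_add hjn (partLoad mkt (t s))
  have e2 := Market.tail_eq_add hjn (partLoad mkt (t o))
  have hW := Market.strictAntiOn_W h (Market.tail_mem h (ht.isLoad h o) (by omega : 1 ≤ j + 1))
    (Market.tail_mem h (ht.isLoad h o) hj1)
    (by rw [e2]; exact lt_add_of_pos_left _ (mul_pos (h.q_pos j hj) ho))
  have h1 := hle s
  simp only [partLoad, h0, mul_zero, zero_add] at e1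
  rw [e1, heq s hs] at h1
  exact (mul_lt_mul_of_pos_left hW (hpos o)).not_ge h1

theorem tail_eq_zero (h : mkt.IsStandard) (ht : IsSelection mkt I t)
    (hpos : ∀ s, (0 : ℝ) < (I s).card) {j : ℕ} (hj : 1 ≤ j) {s : Fin d}
    (hs : t s j = 0) : mkt.tail (partLoad mkt (t s)) j = 0 := by
  have key : ∀ k, j ≤ k → k ≤ mkt.n → t s k = 0 := by
    intro k hjk
    induction k, hjk using Nat.le_induction with
    | base => exact fun _ => hs
    | succ k hjk ih =>
      intro hk
      have hk' : k + 1 ∈ mkt.states := Market.mem_states.2 ⟨by omega, hk⟩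
      by_contra hne
      exact (ht.pos_of_pos_succ h hpos (Market.mem_states.2 ⟨by omega, by omega⟩) hk'
        ((ht.nonneg hk' s).lt_of_ne' hne)).ne' (ih (by omega))
  refine Finset.sum_eq_zero fun k hk => ?_
  rw [Finset.mem_Icc] at hk
  simp [partLoad, key k hk.1 hk.2]

/-- Every part is compared with the first one, by induction on the state. Parts in use share the
end-points of the first part, hence its total profit. For an unused part the upper end-point is at
least as high, and the ratio assumption carries the profit inequality from one state to the next. -/
theorem profit_aux (h : mkt.IsStandard) (ht : IsSelection mkt I t)
    (hpos : ∀ s, (0 : ℝ) < (I s).card) {j : ℕ} (hj1 : 1 ≤ j) (hjn : j ≤ mkt.n) (o s : Fin d)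
    (ho : (o : ℕ) = 0) :
    mkt.L (partLoad mkt (t o)) (j - 1) ≤ mkt.L (partLoad mkt (t s)) (j - 1) ∧
    ((I s).card : ℝ) * (mkt.p (partLoad mkt (t s)) j - mkt.c) ≤
      ((I o).card : ℝ) * (mkt.p (partLoad mkt (t o)) j - mkt.c) ∧
    (0 < t s j → mkt.L (partLoad mkt (t s)) (j - 1) = mkt.L (partLoad mkt (t o)) (j - 1) ∧
      ((I s).card : ℝ) * (mkt.p (partLoad mkt (t s)) j - mkt.c) =
        ((I o).card : ℝ) * (mkt.p (partLoad mkt (t o)) j - mkt.c)) := by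
  have hls := ht.isLoad h s
  have hlo := ht.isLoad h o
  have comm3 : ∀ a b c : ℝ, a * (b * c) = b * (a * c) := fun a b c => by ring
  induction j, hj1 using Nat.le_induction with
  | base =>
    have hs : 1 ∈ mkt.states := Market.mem_states.2 ⟨le_rfl, hjn⟩
    obtain ⟨-, hle, heq⟩ := ht.exists_level hs o ho
    have hf := sub_pos.2 (Market.c_lt_f h hs (h.g_c_lt_v 1 hs) le_rfl)
    simp only [Market.p_sub_c, Nat.sub_self, Market.L]
    refine ⟨le_rfl, ?_, fun hts => ⟨trivial, ?_⟩⟩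
    · rw [comm3, comm3 _ (mkt.f 1 mkt.v - mkt.c)]
      exact mul_le_mul_of_nonneg_left (hle s) hf.le
    · rw [comm3, comm3 _ (mkt.f 1 mkt.v - mkt.c), heq s hts]
  | succ j hj1 ih =>
    obtain ⟨ihL, ihle, iheq⟩ := ih (by omega)
    have hjs : j ∈ mkt.states := Market.mem_states.2 ⟨hj1, by omega⟩
    have hjs' : j + 1 ∈ mkt.states := Market.mem_states.2 ⟨by omega, hjn⟩
    obtain ⟨hto, hle, heq⟩ := ht.exists_level hjs' o ho
    have hWs := Market.W_tail_pos h hls (by omega : 1 ≤ j + 1)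
    have hWo := Market.W_tail_pos h hlo (by omega : 1 ≤ j + 1)
    have es : mkt.p (partLoad mkt (t s)) j - mkt.c =
        (mkt.f j (mkt.L (partLoad mkt (t s)) j) - mkt.c) *
          mkt.W (mkt.tail (partLoad mkt (t s)) (j + 1)) := by
      rw [Market.f_L_sub_c h hls hjs, div_mul_cancel₀ _ hWs.ne']
    have eo : mkt.p (partLoad mkt (t o)) j - mkt.c =
        (mkt.f j (mkt.L (partLoad mkt (t o)) j) - mkt.c) *
          mkt.W (mkt.tail (partLoad mkt (t o)) (j + 1)) := by
      rw [Market.f_L_sub_c h hlo hjs, div_mul_cancel₀ _ hWo.ne']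
    have hlam := mul_pos (hpos o) hWo
    have hLs := Market.L_mem_penalties h hls hjs le_rfl
    have hLo := Market.L_mem_penalties h hlo hjs le_rfl
    rcases (ht.nonneg hjs' s).eq_or_lt with h0 | hpos'
    -- By nestedness an unused part has no load from any higher state either, so its `W` factor is
    -- 1.
    · have hts := ht.tail_eq_zero h hpos (by omega : 1 ≤ j + 1) h0.symm
      have hMle := hle s
      rw [hts, Market.W_zero h, mul_one] at hMle
      rw [hts, Market.W_zero h, mul_one] at es
      have hL : mkt.L (partLoad mkt (t o)) j ≤ mkt.L (partLoad mkt (t s)) j := by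
        -- If the part was unused in state `j` too, its interval is a point and the old end-point
        -- comparison persists. If it was used, equal profits in state `j` and the level inequality
        -- in state `j + 1` order the end-points.
        rcases (ht.nonneg hjs s).eq_or_lt with h0' | hact
        · have hts' := ht.tail_eq_zero h hpos hj1 h0'.symm
          rw [Market.p_sub_c, hts', Market.W_zero h, mul_one] at es
          have := (Market.strictMonoOn_f h hjs).injOn
            (Market.L_mem_penalties h hls hjs (by omega)) hLs (sub_left_injective es)
          rw [← this]
          exact (Market.L_antitone h hlo (by omega) (by omega)).trans ihL
        · have e := (iheq hact).2
          rw [es, eo, comm3 ((I o).card : ℝ), mul_comm] at e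
          have hf := sub_pos.2 (Market.c_lt_f_L h hlo hjs le_rfl)
          have h1 : (mkt.f j (mkt.L (partLoad mkt (t o)) j) - mkt.c) * ((I s).card : ℝ) ≤
              (mkt.f j (mkt.L (partLoad mkt (t s)) j) - mkt.c) * ((I s).card : ℝ) := by
            rw [e]
            exact mul_le_mul_of_nonneg_left hMle hf.le
          have h2 := le_of_mul_le_mul_right h1 (hpos s)
          exact ((Market.strictMonoOn_f h hjs).le_iff_le hLo hLs).1 (by linarith)
      refine ⟨hL, ?_, fun hlt => absurd h0 hlt.ne⟩
      rw [Market.p_sub_c, Market.p_sub_c, hts, Market.W_zero h, mul_one, Nat.add_sub_cancel]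
      rw [es, eo] at ihle
      have hr := Market.profit_mul_le h hjs hjs' (by omega)
        (Market.g_c_lt_L h hlo hjs le_rfl) hL (Market.L_le_v h hls (by omega))
      have hfo := sub_pos.2 (Market.c_lt_f_L h hlo hjs le_rfl)
      have hfo' := sub_pos.2 (Market.c_lt_f_L h hlo hjs' (by omega : j ≤ j + 1))
      refine le_of_mul_le_mul_left ?_ hfo
      have h1 := mul_le_mul_of_nonneg_left hr (hpos s).le
      have h2 := mul_le_mul_of_nonneg_right ihle hfo'.le
      linarith
    · have hact := ht.pos_of_pos_succ h hpos hjs hjs' hpos'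
      have hlev := heq s hpos'
      have e := (iheq hact).2
      rw [es, eo, comm3, comm3 ((I o).card : ℝ), hlev] at e
      have hL : mkt.L (partLoad mkt (t s)) j = mkt.L (partLoad mkt (t o)) j :=
        (Market.strictMonoOn_f h hjs).injOn hLs hLo
          (sub_left_injective (mul_right_cancel₀ hlam.ne' e))
      have hfin : ((I s).card : ℝ) * (mkt.p (partLoad mkt (t s)) (j + 1) - mkt.c) =
          ((I o).card : ℝ) * (mkt.p (partLoad mkt (t o)) (j + 1) - mkt.c) := by
        rw [Market.p_sub_c, Market.p_sub_c, Nat.add_sub_cancel, hL, comm3,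
          comm3 ((I o).card : ℝ), hlev]
      exact ⟨hL.ge, hfin.le, fun _ => ⟨hL, hfin⟩⟩

/-- The total profit from all nodes of a part of the partition is the same for all parts that are
used in state `j`, and not larger for the others. -/
theorem exists_profit (h : mkt.IsStandard) (ht : IsSelection mkt I t)
    (hpos : ∀ s, (0 : ℝ) < (I s).card) (hd : 0 < d) {j : ℕ} (hj : j ∈ mkt.states) :
    ∃ U : ℝ, 0 ≤ U ∧
      (∀ s, ((I s).card : ℝ) * (mkt.p (partLoad mkt (t s)) j - mkt.c) ≤ U) ∧
      ∀ s, 0 < t s j → ((I s).card : ℝ) * (mkt.p (partLoad mkt (t s)) j - mkt.c) = U := by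
  obtain ⟨hj1, hjn⟩ := Market.mem_states.1 hj
  refine ⟨((I ⟨0, hd⟩).card : ℝ) * (mkt.p (partLoad mkt (t ⟨0, hd⟩)) j - mkt.c), ?_, fun s => ?_,
    fun s hs => ?_⟩
  · exact mul_nonneg (hpos _).le (Market.p_sub_c_pos h (ht.isLoad h _) hj).le
  · exact (ht.profit_aux h hpos hj1 hjn _ s rfl).2.1
  · exact ((ht.profit_aux h hpos hj1 hjn _ s rfl).2.2 hs).2

end IsSelection

end SpectrumMarket

/-! ### The probability of a sale against independent competitors. -/

namespace SpectrumMarket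

/-- An atom would make the distribution function skip the value halfway up its jump. -/
theorem measure_singleton_eq_zero_of_exists_cdf_eq (P : Measure ℝ) [IsProbabilityMeasure P]
    (hP : ∀ u ∈ Set.Icc (0 : ℝ) 1, ∃ y, P.real (Set.Iic y) = u) (x : ℝ) : P {x} = 0 := by
  by_contra hne
  have hpos : 0 < P.real {x} := ENNReal.toReal_pos hne (measure_ne_top _ _)
  have hadd : P.real (Set.Iic x) = P.real (Set.Iio x) + P.real {x} := by
    rw [← Set.Iio_union_right, measureReal_union (by simp) (measurableSet_singleton x)]
  have h1 : P.real (Set.Iic x) ≤ 1 := measureReal_le_one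
  have h0 : 0 ≤ P.real (Set.Iio x) := measureReal_nonneg
  obtain ⟨y, hy⟩ := hP (P.real (Set.Iio x) + P.real {x} / 2) ⟨by linarith, by linarith⟩
  rcases lt_or_ge y x with hlt | hge
  · have := measureReal_mono (μ := P) (Set.Iic_subset_Iio.2 hlt)
    linarith
  · have := measureReal_mono (μ := P) (Set.Iic_subset_Iic.2 hge)
    linarith

/-- The event splits according to the exact set `T` of coordinates falling in `A`. Each piece is a
box, and its probability depends only on the size of `T`, which gives a binomial sum. -/
theorem measureReal_pi_card_lt {ι Ω : Type*} [Fintype ι] [MeasurableSpace Ω] (μ : ι → Measure Ω)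
    [∀ i, IsProbabilityMeasure (μ i)] {A : Set Ω} [DecidablePred (· ∈ A)] (hA : MeasurableSet A)
    {F : ℝ} (hF : ∀ i, (μ i).real A = F) (m : ℕ) :
    MeasurableSet {y : ι → Ω | (Finset.univ.filter fun k => y k ∈ A).card < m} ∧
    (Measure.pi μ).real {y | (Finset.univ.filter fun k => y k ∈ A).card < m} =
      ∑ i ∈ Finset.range (Fintype.card ι + 1), ((Fintype.card ι).choose i : ℝ) *
        if i < m then F ^ i * (1 - F) ^ (Fintype.card ι - i) else 0 := by
  classical
  have hmeas : ∀ T : Finset ι, MeasurableSet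
      (Set.univ.pi fun k => if k ∈ T then A else Aᶜ) := fun T =>
    MeasurableSet.univ_pi fun k => by
      split_ifs
      exacts [hA, hA.compl]
  have hmem : ∀ (T : Finset ι) (y : ι → Ω), (y ∈ Set.univ.pi fun k => if k ∈ T then A else Aᶜ) ↔
      (Finset.univ.filter fun k => y k ∈ A) = T := by
    intro T y
    simp only [Set.mem_univ_pi, Finset.ext_iff, Finset.mem_filter, Finset.mem_univ, true_and]
    refine forall_congr' fun k => ?_
    by_cases hk : k ∈ T <;> simp [hk]
  have hset : {y : ι → Ω | (Finset.univ.filter fun k => y k ∈ A).card < m} =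
      ⋃ T ∈ Finset.univ.filter fun T : Finset ι => T.card < m,
        Set.univ.pi fun k => if k ∈ T then A else Aᶜ := by
    ext y
    simp [-Set.mem_pi, hmem]
  have hval : ∀ T : Finset ι, (Measure.pi μ).real (Set.univ.pi fun k => if k ∈ T then A else Aᶜ) =
      F ^ T.card * (1 - F) ^ (Fintype.card ι - T.card) := by
    intro T
    rw [measureReal_def, Measure.pi_pi, ENNReal.toReal_prod]
    have : ∀ k, (μ k (if k ∈ T then A else Aᶜ)).toReal = if k ∈ T then F else 1 - F := by
      intro k
      split_ifs
      · exact hF k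
      · rw [← hF k]
        exact probReal_compl_eq_one_sub hA
    simp only [this]
    rw [Finset.prod_ite, Finset.prod_const, Finset.prod_const, Finset.filter_not,
      ← Finset.compl_eq_univ_sdiff, Finset.card_compl]
    simp
  refine ⟨hset ▸ Finset.measurableSet_biUnion _ fun T _ => hmeas T, ?_⟩
  rw [hset, measureReal_biUnion_finset]
  · simp only [hval]
    rw [Finset.sum_filter, ← Finset.powerset_univ, Finset.sum_powerset_apply_card
      (fun i => if i < m then F ^ i * (1 - F) ^ (Fintype.card ι - i) else 0)]
    simp [Finset.card_univ]
  · intro T _ T' _ hne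
    refine Set.disjoint_left.2 fun y hy hy' => hne ?_
    rw [← (hmem T y).1 hy, (hmem T' y).1 hy']
  · exact fun T _ => hmeas T

theorem Market.W_eq_sum {mkt : Market} (F : ℝ) :
    mkt.W F = ∑ i ∈ Finset.range (mkt.l - 1 + 1), ((mkt.l - 1).choose i : ℝ) *
        if i < mkt.m then F ^ i * (1 - F) ^ (mkt.l - 1 - i) else 0 := by
  have hb : ∑ i ∈ Finset.range (mkt.l - 1 + 1),
      ((mkt.l - 1).choose i : ℝ) * F ^ i * (1 - F) ^ (mkt.l - 1 - i) = 1 := by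
    have := add_pow F (1 - F) (mkt.l - 1)
    rw [add_sub_cancel, one_pow] at this
    refine Eq.trans ?_ this.symm
    exact Finset.sum_congr rfl fun i _ => by ring
  rw [← Finset.sum_filter_add_sum_filter_not _ fun i => i < mkt.m] at hb
  have hIcc : (Finset.range (mkt.l - 1 + 1)).filter (fun i => ¬ i < mkt.m) =
      Finset.Icc mkt.m (mkt.l - 1) := by
    ext i
    simp only [Finset.mem_filter, Finset.mem_range, Finset.mem_Icc]
    omega
  rw [hIcc, Finset.sum_filter] at hb
  rw [W, w, ← eq_sub_of_add_eq hb]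
  exact Finset.sum_congr rfl fun i _ => by split_ifs <;> ring

variable {V : Type*} [Fintype V] [DecidableEq V] {mkt : Market} {G : SimpleGraph V}

theorem saleProb_of_lt {ι : Type*} [Fintype ι] {x : ℝ} (hx : mkt.v < x) (y : ι → EReal) :
    saleProb mkt x y = 0 := by
  simp [saleProb, hx]

open Classical in
theorem saleProb_of_forall_ne {ι : Type*} [Fintype ι] {x : ℝ} (hx : x ≤ mkt.v) {y : ι → EReal}
    (hy : ∀ k, y k ≠ x) : saleProb mkt x y =
      Set.indicator {y : ι → EReal | (Finset.univ.filter fun k =>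
        y k ∈ Set.Iio (x : EReal)).card < mkt.m} 1 y := by
  simp only [saleProb, hx.not_gt, false_or, hy, Finset.filter_false, Finset.card_empty,
    Set.indicator_apply, Set.mem_Iio, Set.mem_ofPred_eq, Pi.one_apply]
  split_ifs with h1 h2 h2
  · omega
  · rfl
  · have : ((Finset.univ.filter fun k => y k < (x : EReal)).card : ℝ) + 1 ≤ mkt.m := by
      exact_mod_cast h2
    rw [Nat.cast_zero, zero_add, div_one, min_eq_left (by linarith)]
  · omega

theorem winProb_of_lt (S : Fin mkt.l → Strategy mkt G) (i : Fin mkt.l) (a : V) {x : ℝ}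
    (hx : mkt.v < x) : winProb S i a x = 0 := by
  simp [winProb, saleProb_of_lt hx]

/-- Without atoms ties have probability zero, so a sale occurs exactly when fewer than `m`
competitors undercut `x`. -/
theorem winProb_eq_W (S : Fin mkt.l → Strategy mkt G) (i : Fin mkt.l) (a : V) {x F : ℝ}
    (hx : x ≤ mkt.v) (hprob : ∀ k, IsProbabilityMeasure (offerLaw (S k) a))
    (hatom : ∀ k, offerLaw (S k) a {(x : EReal)} = 0)
    (hF : ∀ k, (offerLaw (S k) a).real (Set.Iio (x : EReal)) = F) :
    winProb S i a x = mkt.W F := by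
  classical
  have hne : ∀ᵐ y ∂(Measure.pi fun k : {k : Fin mkt.l // k ≠ i} => offerLaw (S k) a),
      ∀ k, y k ≠ (x : EReal) := by
    rw [ae_all_iff]
    intro k
    have := Measure.pi_eval_preimage_null
      (fun k : {k : Fin mkt.l // k ≠ i} => offerLaw (S k) a) (hatom k)
    rw [ae_iff]
    convert this using 2
    ext y
    simp
  obtain ⟨hm, hv⟩ := measureReal_pi_card_lt
    (fun k : {k : Fin mkt.l // k ≠ i} => offerLaw (S k) a)
    (measurableSet_Iio (a := (x : EReal))) (fun k => hF k) mkt.m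
  have hcard : Fintype.card {k : Fin mkt.l // k ≠ i} = mkt.l - 1 := by
    simp [Fintype.card_subtype_compl]
  rw [winProb, integral_congr_ae (hne.mono fun y hy => saleProb_of_forall_ne hx hy),
    Market.W_eq_sum, ← hcard, ← hv]
  convert integral_indicator_one hm using 3

/-- At the node `a`, the strategy `σ` offers a channel of state `k` with probability `α k`, and
with the penalty distribution `phi α k`. -/
def OffersAt (σ : Strategy mkt G) (a : V) (α : ℕ → ℝ) : Prop :=
  ∀ k ∈ mkt.states, nodeProb σ a k = α k ∧
    ∀ A, a ∈ A → (σ k).β A ≠ 0 → ∀ x, ((σ k).pen A a).real (Set.Iic x) = mkt.phi α k x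

theorem offerLaw_apply (h : mkt.IsStandard) (σ : Strategy mkt G) (a : V)
    (hle : ∑ j ∈ mkt.states, nodeProb σ a j ≤ 1) {s : Set EReal} (hs : MeasurableSet s) :
    offerLaw σ a s = ENNReal.ofReal ((1 - ∑ j ∈ mkt.states, nodeProb σ a j) *
        s.indicator 1 ⊤ + ∑ j ∈ mkt.states, ∑ A : Finset V with a ∈ A,
          mkt.q j * (σ j).β A * ((σ j).pen A a).real ((fun x : ℝ => (x : EReal)) ⁻¹' s)) := by
  have h1 : ∀ j ∈ mkt.states, ∀ A, 0 ≤ mkt.q j * (σ j).β A *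
      ((σ j).pen A a).real ((fun x : ℝ => (x : EReal)) ⁻¹' s) := fun j hj A =>
    mul_nonneg (mul_nonneg (h.q_pos j hj).le ((σ j).β_nonneg A)) measureReal_nonneg
  have h2 : (0 : ℝ) ≤ s.indicator 1 (⊤ : EReal) :=
    Set.indicator_nonneg (fun _ _ => zero_le_one) _
  rw [ENNReal.ofReal_add (mul_nonneg (sub_nonneg.2 hle) h2)
    (Finset.sum_nonneg fun j hj => Finset.sum_nonneg fun A _ => h1 j hj A),
    ENNReal.ofReal_mul (sub_nonneg.2 hle),
    ENNReal.ofReal_sum_of_nonneg fun j hj => Finset.sum_nonneg fun A _ => h1 j hj A]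
  simp only [offerLaw, Measure.add_apply, Measure.smul_apply, Measure.finsetSum_apply, smul_eq_mul]
  congr 1
  · rw [Measure.dirac_apply' _ hs]
    by_cases hT : (⊤ : EReal) ∈ s <;> simp [hT]
  · refine Finset.sum_congr rfl fun j hj => ?_
    rw [ENNReal.ofReal_sum_of_nonneg fun A _ => h1 j hj A]
    refine Finset.sum_congr rfl fun A _ => ?_
    have := (σ j).pen_prob A a
    rw [ENNReal.ofReal_mul (mul_nonneg (h.q_pos j hj).le ((σ j).β_nonneg A)),
      Measure.map_apply measurable_coe_real_ereal hs, ofReal_measureReal]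

theorem OffersAt.pen_singleton (h : mkt.IsStandard) {σ : Strategy mkt G} {a : V} {α : ℕ → ℝ}
    (hα : mkt.IsLoad α) (hσ : OffersAt σ a α) {k : ℕ} (hk : k ∈ mkt.states) {A : Finset V}
    (ha : a ∈ A) (hA : (σ k).β A ≠ 0) (x : ℝ) : (σ k).pen A a {x} = 0 := by
  have := (σ k).pen_prob A a
  have hαk : α k ≠ 0 := by
    rw [← (hσ k hk).1]
    refine (lt_of_lt_of_le (mul_pos (h.q_pos k hk) (((σ k).β_nonneg A).lt_of_ne' hA))
      (Finset.single_le_sum (f := fun A => mkt.q k * (σ k).β A) (fun B _ => ?_)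
        (Finset.mem_filter.2 ⟨Finset.mem_univ A, ha⟩))).ne'
    exact mul_nonneg (h.q_pos k hk).le ((σ k).β_nonneg B)
  refine measure_singleton_eq_zero_of_exists_cdf_eq _ (fun u hu => ?_) x
  simp only [(hσ k hk).2 A ha hA]
  exact Market.exists_phi_eq h hα hk hαk hu

theorem OffersAt.offerLaw (h : mkt.IsStandard) {σ : Strategy mkt G} {a : V} {α : ℕ → ℝ}
    (hα : mkt.IsLoad α) (hσ : OffersAt σ a α) :
    IsProbabilityMeasure (offerLaw σ a) ∧ (∀ x : ℝ, offerLaw σ a {(x : EReal)} = 0) ∧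
      ∀ x : ℝ, (offerLaw σ a).real (Set.Iio (x : EReal)) = mkt.offerCdf α x := by
  have hle : ∑ j ∈ mkt.states, nodeProb σ a j ≤ 1 := by
    refine le_trans (Finset.sum_le_sum fun k hk => ?_) h.sum_q_lt_one.le
    rw [(hσ k hk).1]
    exact (hα k hk).2
  have hterm : ∀ k ∈ mkt.states, ∀ A ∈ Finset.univ.filter (fun A : Finset V => a ∈ A),
      ∀ x : ℝ, mkt.q k * (σ k).β A * ((σ k).pen A a).real {x} = 0 := fun k hk A hA x => by
    by_cases hβ : (σ k).β A = 0
    · rw [hβ, mul_zero, zero_mul]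
    · rw [measureReal_def, hσ.pen_singleton h hα hk (Finset.mem_filter.1 hA).2 hβ]
      simp
  refine ⟨⟨?_⟩, fun x => ?_, fun x => ?_⟩
  · rw [offerLaw_apply h σ a hle MeasurableSet.univ]
    have : ∀ k A, ((σ k).pen A a).real Set.univ = 1 := fun k A => by
      have := (σ k).pen_prob A a
      exact probReal_univ
    simp only [Set.preimage_univ, this, mul_one]
    rw [← ENNReal.ofReal_one]
    congr 1
    simp [nodeProb]
  · rw [offerLaw_apply h σ a hle (measurableSet_singleton _)]
    have hpre : (fun x : ℝ => (x : EReal)) ⁻¹' {(x : EReal)} = {x} := by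
      ext y
      simp
    rw [hpre, Finset.sum_eq_zero fun k hk => Finset.sum_eq_zero fun A hA => hterm k hk A hA x]
    simp
  · have hpre : (fun x : ℝ => (x : EReal)) ⁻¹' Set.Iio (x : EReal) = Set.Iio x := by
      ext y
      simp
    have hnn : 0 ≤ ∑ j ∈ mkt.states, ∑ A : Finset V with a ∈ A,
        mkt.q j * (σ j).β A * ((σ j).pen A a).real (Set.Iio x) :=
      Finset.sum_nonneg fun j hj => Finset.sum_nonneg fun A _ =>
        mul_nonneg (mul_nonneg (h.q_pos j hj).le ((σ j).β_nonneg A)) measureReal_nonneg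
    -- A channel that is not offered has the value `⊤` and never undercuts.
    have htop : (⊤ : EReal) ∉ Set.Iio (x : EReal) := by simp
    rw [measureReal_def, offerLaw_apply h σ a hle measurableSet_Iio, hpre,
      Set.indicator_of_notMem htop, mul_zero, zero_add, ENNReal.toReal_ofReal hnn]
    refine Finset.sum_congr rfl fun k hk => ?_
    rw [← (hσ k hk).1, nodeProb, Finset.sum_mul]
    refine Finset.sum_congr rfl fun A hA => ?_
    by_cases hβ : (σ k).β A = 0
    · simp [hβ]
    have hA' := (Finset.mem_filter.1 hA).2
    have := (σ k).pen_prob A a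
    have h0 : ((σ k).pen A a).real {x} = 0 := by
      rw [measureReal_def, hσ.pen_singleton h hα hk hA' hβ]
      simp
    rw [← (hσ k hk).2 A hA' hβ, ← Set.Iio_union_right,
      measureReal_union (by simp) (measurableSet_singleton x), h0, add_zero]

theorem winProb_eq_W_offerCdf (h : mkt.IsStandard) {S : Fin mkt.l → Strategy mkt G} {a : V}
    {α : ℕ → ℝ} (hα : mkt.IsLoad α) (hS : ∀ k, OffersAt (S k) a α) (i : Fin mkt.l) {x : ℝ}
    (hx : x ≤ mkt.v) :
    winProb S i a x = mkt.W (mkt.offerCdf α x) ∧ mkt.offerCdf α x ∈ Set.Icc (0 : ℝ) 1 := by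
  have hp := ((hS i).offerLaw h hα).1
  refine ⟨winProb_eq_W S i a hx (fun k => ((hS k).offerLaw h hα).1)
    (fun k => ((hS k).offerLaw h hα).2.1 x) fun k => ((hS k).offerLaw h hα).2.2 x, ?_⟩
  rw [← ((hS i).offerLaw h hα).2.2 x]
  exact ⟨measureReal_nonneg, measureReal_le_one⟩

end SpectrumMarket

/-! ### Common behaviour under both partitions, and the equilibrium property. -/

namespace SpectrumMarket

namespace Market

variable {mkt : Market} {α β : ℕ → ℝ}

theorem p_congr (hβ : ∀ k ∈ mkt.states, α k = β k) {j : ℕ} (hj : 1 ≤ j) :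
    mkt.p α j = mkt.p β j := by
  rw [p, p, L_congr hβ, tail_congr hβ hj]

theorem phi_congr (hβ : ∀ k ∈ mkt.states, α k = β k) {j : ℕ} (hj : j ∈ mkt.states) (x : ℝ) :
    mkt.phi α j x = mkt.phi β j x := by
  rw [phi, phi, L_congr hβ, L_congr hβ, p_congr hβ (mem_states.1 hj).1, hβ j hj,
    tail_congr hβ (by omega : 1 ≤ j + 1)]

end Market

variable {V : Type*} [Fintype V] [DecidableEq V] {mkt : Market} {G : SimpleGraph V} {d : ℕ}
  {I J : Fin d → Finset V} {t : Fin d → ℕ → ℝ} {j : ℕ}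

/-- The parts exhaust the total mass 1, so a strategy that follows a partition selects nothing else.
-/
theorem StateStrategy.exists_eq_of_sum_eq_one (ψ : StateStrategy mkt G j)
    (hJ : Function.Injective J) (hsum : ∑ s, ψ.β (J s) = 1) {A : Finset V} (hA : ψ.β A ≠ 0) :
    ∃ s, A = J s := by
  by_contra! hne
  have hA' : A ∉ Finset.univ.image J := by
    simpa using fun s => (hne s).symm
  have h1 : ∑ B ∈ insert A (Finset.univ.image J), ψ.β B ≤ ∑ B, ψ.β B :=
    Finset.sum_le_sum_of_subset_of_nonneg (Finset.subset_univ _) fun B _ _ => ψ.β_nonneg B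
  rw [Finset.sum_insert hA', Finset.sum_image hJ.injOn, hsum, ψ.β_sum] at h1
  exact hA (le_antisymm (by linarith) (ψ.β_nonneg A))

/-- Whichever partition `J` and selection a primary uses, its behaviour at each node is expressed
through one reference pair `I`, `t`. This makes all competitors identically distributed at a node
even when they mix partitions across primaries and states. -/
theorem FollowsPartition.offers [Nonempty V] (h : mkt.IsStandard)
    (hI : IsMeanValidPartition G I) (ht : IsSelection mkt I t) (hJ : IsMeanValidPartition G J)
    (hj : j ∈ mkt.states) {ψ : StateStrategy mkt G j} (hψ : FollowsPartition ψ J) :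
    (∀ a, ∑ A : Finset V with a ∈ A, mkt.q j * ψ.β A = mkt.q j * t (hI.part a) j) ∧
    ∀ A, ψ.β A ≠ 0 → A.Nonempty ∧ ∀ a ∈ A, (I (hI.part a)).card = A.card ∧
      0 < t (hI.part a) j ∧
      ∀ x, (ψ.pen A a).real (Set.Iic x) = mkt.phi (partLoad mkt (t (hI.part a))) j x := by
  obtain ⟨t', ht', hβ, hpen⟩ := hψ
  have hcard := hI.card_eq hJ
  have heq : ∀ a, ∀ k ∈ mkt.states, t (hI.part a) k = t' (hJ.part a) k := fun a k hk =>
    ht.eq_of_card_eq h ht' hcard hI.card_pos hk (hI.card_part_eq hJ a)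
  have hA : ∀ A, ψ.β A ≠ 0 → ∃ r, A = J r := fun A hA =>
    ψ.exists_eq_of_sum_eq_one hJ.injective (by simp only [hβ, (ht' j hj).1]) hA
  refine ⟨fun a => ?_, fun A hne => ?_⟩
  · rw [Finset.sum_eq_single (J (hJ.part a)), hβ, heq a j hj]
    · intro A hmem hne
      rw [mul_eq_zero]
      right
      by_contra hβA
      obtain ⟨r, rfl⟩ := hA A hβA
      rw [hJ.mem_iff.1 (Finset.mem_filter.1 hmem).2] at hne
      exact hne rfl
    · intro hn
      rw [Finset.mem_filter, hJ.mem_iff] at hn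
      exact absurd ⟨Finset.mem_univ _, rfl⟩ hn
  · obtain ⟨r, rfl⟩ := hA A hne
    have hpos : 0 < t' r j := (ht'.nonneg hj r).lt_of_ne' (hβ r ▸ hne)
    refine ⟨hJ.nonempty r, fun a ha => ?_⟩
    have har := hJ.mem_iff.1 ha
    have heqa := heq a
    have hc := hI.card_part_eq hJ a
    rw [har] at heqa hc
    refine ⟨hc, by rwa [heqa j hj], fun x => ?_⟩
    rw [hpen r hpos a ha x]
    exact Market.phi_congr (fun k hk => by simp only [partLoad, heqa k hk]) hj x

theorem integral_profit_eq (h : mkt.IsStandard) {α : ℕ → ℝ} (hα : mkt.IsLoad α)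
    (hj : j ∈ mkt.states) (hαj : α j ≠ 0) (P : Measure ℝ) [IsProbabilityMeasure P]
    (hP : ∀ x, P.real (Set.Iic x) = mkt.phi α j x) {u : ℝ → ℝ}
    (hu : ∀ x ≤ mkt.v, u x = mkt.W (mkt.offerCdf α x)) :
    ∫ x, (mkt.f j x - mkt.c) * u x ∂P = mkt.p α j - mkt.c := by
  have h0 : ∀ᵐ x ∂P, mkt.L α j < x := by
    have := hP (mkt.L α j)
    rw [Market.phi_of_le_L h hα hj hαj le_rfl, measureReal_eq_zero_iff] at this
    rw [ae_iff]
    convert this using 2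
    ext x
    simp
  have h1 : ∀ᵐ x ∂P, x ≤ mkt.L α (j - 1) := by
    have := hP (mkt.L α (j - 1))
    rw [Market.phi_of_L_pred_le h hα hj hαj le_rfl] at this
    have hc := probReal_compl_eq_one_sub (μ := P) (measurableSet_Iic (a := mkt.L α (j - 1)))
    rw [this, sub_self, measureReal_eq_zero_iff] at hc
    exact hc
  have hae : ∀ᵐ x ∂P, (mkt.f j x - mkt.c) * u x = mkt.p α j - mkt.c := by
    filter_upwards [h0, h1] with x hx0 hx1
    rw [hu x (hx1.trans (Market.L_le_v h hα (by have := (Market.mem_states.1 hj).2; omega))),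
      Market.profit_mul_W_offerCdf h hα hj ⟨hx0.le, hx1⟩]
  rw [integral_congr_ae hae]
  simp

theorem integral_profit_le (h : mkt.IsStandard) {α : ℕ → ℝ} (hα : mkt.IsLoad α)
    (hj : j ∈ mkt.states) (P : Measure ℝ) [IsProbabilityMeasure P]
    (hP : ∀ᵐ x ∂P, x ∈ mkt.penalties j) {u : ℝ → ℝ}
    (hu : ∀ x ≤ mkt.v, u x = mkt.W (mkt.offerCdf α x) ∧
      mkt.offerCdf α x ∈ Set.Icc (0 : ℝ) 1) (hu' : ∀ x, mkt.v < x → u x = 0) :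
    ∫ x, (mkt.f j x - mkt.c) * u x ∂P ≤ mkt.p α j - mkt.c := by
  have hp := (Market.p_sub_c_pos h hα hj).le
  have hae : ∀ᵐ x ∂P, (mkt.f j x - mkt.c) * u x ≤ mkt.p α j - mkt.c := by
    filter_upwards [hP] with x hx
    rcases le_or_gt x mkt.v with hxv | hxv
    · rw [(hu x hxv).1]
      exact Market.profit_mul_W_offerCdf_le h hα hj hx hxv (hu x hxv).2
    · rwa [hu' x hxv, mul_zero]
  by_cases hint : Integrable (fun x => (mkt.f j x - mkt.c) * u x) P
  · simpa using integral_mono_ae hint (integrable_const (mkt.p α j - mkt.c)) hae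
  -- A non-integrable profit has integral 0 by convention, still at most the positive `p α j - c`.
  · rwa [integral_undef hint]

theorem isNash_of_follows [Nonempty V] (h : mkt.IsStandard) (hI : IsMeanValidPartition G I)
    (hJ : IsMeanValidPartition G J) (S : Fin mkt.l → Strategy mkt G)
    (hS : ∀ i, ∀ j ∈ mkt.states, FollowsPartition (S i j) I ∨ FollowsPartition (S i j) J) :
    IsNash S := by
  intro i j hj ψ
  -- Any primary's selection serves as reference; one for `J` is also one for `I`, since only the
  -- sizes of the parts enter.
  obtain ⟨t, ht⟩ : ∃ t, IsSelection mkt I t := by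
    rcases hS i j hj with ⟨t, ht, -⟩ | ⟨t, ht, -⟩
    · exact ⟨t, ht⟩
    · exact ⟨t, ht.of_card_eq fun s => (hI.card_eq hJ s).symm⟩
  have hfol : ∀ i, ∀ k ∈ mkt.states,
      (∀ a, ∑ A : Finset V with a ∈ A, mkt.q k * (S i k).β A = mkt.q k * t (hI.part a) k) ∧
      ∀ A, (S i k).β A ≠ 0 → A.Nonempty ∧ ∀ a ∈ A, (I (hI.part a)).card = A.card ∧
        0 < t (hI.part a) k ∧ ∀ x, ((S i k).pen A a).real (Set.Iic x) =
          mkt.phi (partLoad mkt (t (hI.part a))) k x := by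
    intro i k hk
    rcases hS i k hk with hf | hf
    · exact hf.offers h hI ht hI hk
    · exact hf.offers h hI ht hJ hk
  have hload := ht.isLoad h
  have hoff : ∀ a i, OffersAt (S i) a (partLoad mkt (t (hI.part a))) := fun a i k hk =>
    ⟨(hfol i k hk).1 a, fun A ha hA => (((hfol i k hk).2 A hA).2 a ha).2.2⟩
  have hwin : ∀ a, ∀ x ≤ mkt.v, winProb S i a x =
      mkt.W (mkt.offerCdf (partLoad mkt (t (hI.part a))) x) ∧
      mkt.offerCdf (partLoad mkt (t (hI.part a))) x ∈ Set.Icc (0 : ℝ) 1 := fun a x hx =>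
    winProb_eq_W_offerCdf h (hload _) (hoff a) i hx
  obtain ⟨U, hU, hUle, hUeq⟩ := ht.exists_profit h hI.card_pos
    (by have := hI.two_le; omega) hj
  have hdev : expectedPayoff S i j ψ ≤ U := by
    rw [← one_mul U, ← ψ.β_sum, Finset.sum_mul]
    refine Finset.sum_le_sum fun A _ => ?_
    by_cases hA : ψ.β A = 0
    · rw [hA, zero_mul, zero_mul]
    refine mul_le_mul_of_nonneg_left ?_ (ψ.β_nonneg A)
    calc ∑ a ∈ A, ∫ x, (mkt.f j x - mkt.c) * winProb S i a x ∂(ψ.pen A a)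
        -- At each node the best profit is at most `U` divided by the size of its part; mean
        -- validity then bounds the sum of these inverse sizes over `A`.
        ≤ ∑ a ∈ A, U * ((I (hI.part a)).card : ℝ)⁻¹ := by
          refine Finset.sum_le_sum fun a _ => ?_
          have := ψ.pen_prob A a
          refine (integral_profit_le h (hload (hI.part a)) hj _ (ψ.pen_mem A a) (hwin a)
            fun x hx => winProb_of_lt S i a hx).trans ?_
          rw [← div_eq_mul_inv, le_div_iff₀ (hI.card_pos _), mul_comm]
          exact hUle _
      _ ≤ U := by
          rw [← Finset.mul_sum]
          exact mul_le_of_le_one_right hU (hI.sum_inv_le_one (ψ.β_indep A hA))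
  have heq : expectedPayoff S i j (S i j) = U := by
    refine Eq.trans ?_ (one_mul U)
    rw [← (S i j).β_sum, Finset.sum_mul]
    refine Finset.sum_congr rfl fun A _ => ?_
    by_cases hA : (S i j).β A = 0
    · rw [hA, zero_mul, zero_mul]
    congr 1
    obtain ⟨hne, hfA⟩ := (hfol i j hj).2 A hA
    have hterm : ∀ a ∈ A, ∫ x, (mkt.f j x - mkt.c) * winProb S i a x ∂((S i j).pen A a) =
        U * (A.card : ℝ)⁻¹ := by
      intro a ha
      obtain ⟨hc, hpos, hphi⟩ := hfA a ha
      have := (S i j).pen_prob A a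
      rw [integral_profit_eq h (hload (hI.part a)) hj (mul_pos (h.q_pos j hj) hpos).ne' _ hphi
        fun x hx => (hwin a x hx).1, ← hc, ← div_eq_mul_inv,
        eq_div_iff (hI.card_pos _).ne', mul_comm]
      exact hUeq _ hpos
    rw [Finset.sum_congr rfl hterm, Finset.sum_const, nsmul_eq_mul]
    have hcard : (A.card : ℝ) ≠ 0 := Nat.cast_ne_zero.2 hne.card_ne_zero
    field_simp
  rw [heq]
  exact hdev

theorem nodeProb_eq_of_follows [Nonempty V] (h : mkt.IsStandard) (hI : IsMeanValidPartition G I)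
    (hJ : IsMeanValidPartition G J) (σ σ' : Strategy mkt G) (hj : j ∈ mkt.states)
    (hσ : FollowsPartition (σ j) I) (hσ' : FollowsPartition (σ' j) J) (a : V) :
    nodeProb σ a j = nodeProb σ' a j := by
  obtain ⟨t, ht, -⟩ := id hσ
  exact ((hσ.offers h hI ht hI hj).1 a).trans ((hσ'.offers h hI ht hJ hj).1 a).symm

end SpectrumMarket

theorem mainTheorem4 {V : Type*} [Fintype V] [DecidableEq V] [Nonempty V] (G : SimpleGraph V)
    (mkt : SpectrumMarket.Market) (hmkt : mkt.IsStandard) {d d' : ℕ}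
    (I : Fin d → Finset V) (I' : Fin d' → Finset V)
    (hI : SpectrumMarket.IsMeanValidPartition G I)
    (hI' : SpectrumMarket.IsMeanValidPartition G I') :
    (∀ S : Fin mkt.l → SpectrumMarket.Strategy mkt G,
      (∀ i, ∀ j ∈ mkt.states,
        SpectrumMarket.FollowsPartition (S i j) I ∨ SpectrumMarket.FollowsPartition (S i j) I') →
      SpectrumMarket.IsNash S) ∧
    (∀ σ σ' : SpectrumMarket.Strategy mkt G, ∀ j ∈ mkt.states,
      SpectrumMarket.FollowsPartition (σ j) I → SpectrumMarket.FollowsPartition (σ' j) I' →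
      ∀ a, SpectrumMarket.nodeProb σ a j = SpectrumMarket.nodeProb σ' a j) ∧
    (Finset.univ.val.map fun s => (I s).card) = (Finset.univ.val.map fun s => (I' s).card) ∧
    (∀ s r, (I s).card ≠ (I' r).card → Disjoint (I s) (I' r)) := by
  obtain rfl : d' = d := le_antisymm (hI'.length_le hI) (hI.length_le hI')
  exact ⟨SpectrumMarket.isNash_of_follows hmkt hI hI',
    fun σ σ' j hj => SpectrumMarket.nodeProb_eq_of_follows hmkt hI hI' σ σ' hj,
    hI.map_card_eq hI', fun s r => hI.disjoint_of_card_ne hI'⟩
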